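/- Let $H$ be a real Hilbert space with norm $|\cdot|$ and inner product $(\cdot,\cdot)$, let $A:D(A)\subset H\to H$ be a closed, densely defined, self-adjoint, positive definite linear operator with compact resolvent, and let $\{\phi_j\}_{j\ge1}$ be an orthonormal basis of $H$ with $A\phi_j=\lambda_j\phi_j$, $\lambda_1\le\lambda_2\le\cdots$. Let $B\in\mathcal L(H)$, $\delta>0$, let $\beta:[0,\infty)\to\mathbb R$ be the solution of $\beta'+\delta\beta=0$, $\beta(0)=1$, and let $0<\gamma<\delta+1$. Put $\mu_j^{\pm}=\frac12\big(\lambda_j+\delta\pm\sqrt{(\lambda_j-\delta)^2-4\lambda_j}\big)$ (principal complex square root), let $N$ be the largest index $j$ with $\operatorname{Re}\mu_j^+\le\gamma$ or $\operatorname{Re}\mu_j^-\le\gamma$ ($N=0$ if there is none), and let $M$ be the largest multiplicity among the eigenvalues $\lambda_1,\dots,\lambda_N$ ($M=0$ if $N=0$). Define $$P=\begin{pmatrix}0&I_N\\-\operatorname{diag}(\lambda_j(1+\delta))&-\operatorname{diag}(\lambda_j+\delta)\end{pmatrix},\qquad Q=\begin{pmatrix}0\\ C_{NM}\end{pmatrix},\qquad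 (C_{NM})_{ji}=(B\phi_i,\phi_j),\ 1\le j\le N,\ 1\le i\le M .$$ Assume the following rank condition: there are an invertible complex $2N\times2N$ matrix $R$ and a matrix $J$ with $P=R^{-1}JR$, where $J$ is (up to the order of the basis) a direct sum of Jordan blocks and has diagonal $(-\mu_1^+,\dots,-\mu_N^+,-\mu_1^-,\dots,-\mu_N^-)$ (so $J$ is this diagonal matrix when the spectrum is semisimple), such that, with $\overline Q=RQ$, for every distinct eigenvalue $\lambda$ among $\lambda_1,\dots,\lambda_N$, of multiplicity $m$, the $M\times m$ matrix formed by the columns of $\overline Q^{*}$ with indices $\{j\le N:\lambda_j=\lambda\}$ has rank $m$, and the $M\times m$ matrix formed by the columns with indices $\{N+j: j\le N,\ \lambda_j=\lambda\}$ has rank $m$. Then there are $\psi_1,\dots,\psi_M\in\operatorname{span}\{\phi_1,\dots,\phi_M\}$, with $\psi_j=\phi_j$ for all $j$ if all eigenvalues $-\mu_j^\pm$ ($j\le N$) of $P$ are semisimple, and a constant $C>0$, such that for every $y_0\in H$ there is a real controller $$u^*(t)=\sum_{i=1}^{M}B\psi_i\,v_i^*(t)$$ with $v_j^*\in C^2([0,\infty);\mathbb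 R)$ and $$|v_j^*(t)|+|v_j^{*\prime}(t)|+|v_j^{*\prime\prime}(t)|\le Ce^{-\gamma t}|y_0|\qquad\forall\,t\ge0,\ j=1,\dots,M,$$ for which the system $$\frac{dy}{dt}+Ay(t)+\int_0^t\beta(t-s)Ay(s)\,ds=u^*(t),\quad t>0,\qquad y(0)=y_0,$$ has a unique weak solution $y^*$ in $C([0,\infty);H)$ (that is, $\frac{d}{dt}(y,w)+(y,Aw)+\int_0^t\beta(t-s)(y(s),Aw)\,ds=(u^*(t),w)$ for all $t>0$ and all $w\in D(A)$), and this solution satisfies $$y^*\in C^1((0,\infty);H)\cap L^2(0,T;D(A^{1/2}))\cap L^2_{loc}(0,\infty;D(A))\quad\forall\,T>0,\qquad |y^*(t)|\le Ce^{-\gamma t}|y_0|\quad\forall\,t\ge0 .$$ Here $L^2_{loc}(0,\infty;D(A))$ means $L^2(a,b;D(A))$ for all $0<a<b<\infty$. If moreover $y_0\in D(A)$, then $y^*\in C^1([0,T];H)$ for all $T>0$, $y^*\in C([0,\infty);D(A))$, and the equation holds in $H$ for all $t\ge0$. -/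

import Mathlib

open Set MeasureTheory
open scoped InnerProductSpace

noncomputable section

namespace PIDE

section Operator

variable {H : Type*} [NormedAddCommGroup H] [InnerProductSpace ℝ H]

/-- The unbounded operator `A` has compact resolvent: for some `r` in the resolvent set of `A`
the inverse `(r I - A)⁻¹ : H → D(A) ⊆ H` is a compact operator. -/
def HasCompactResolvent (A : H →ₗ.[ℝ] H) : Prop :=
  ∃ (r : ℝ) (T : H →L[ℝ] H), IsCompactOperator T ∧
    (∀ x : A.domain, T (r • (x : H) - A x) = x) ∧
    (∀ z : H, ∃ h : T z ∈ A.domain, r • T z - A ⟨T z, h⟩ = z)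

/-- The standing assumptions on `A : D(A) ⊆ H → H`: closed, densely defined, linear, self-adjoint,
positive definite, with compact resolvent. -/
structure IsAdmissible [CompleteSpace H] (A : H →ₗ.[ℝ] H) : Prop where
  dense : Dense (A.domain : Set H)
  closed : A.IsClosed
  selfAdjoint : IsSelfAdjoint A
  posDef : ∀ x : A.domain, (x : H) ≠ 0 → 0 < ⟪A x, (x : H)⟫_ℝ
  compactResolvent : HasCompactResolvent A

/-- `φ` is an orthonormal basis of `H` made of eigenvectors of `A`, and `lam` lists the
corresponding eigenvalues in nondecreasing order, repeated according to multiplicity.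
(Indices start at `0`: `φ j`, `lam j` are the `(j+1)`-st eigenvector and eigenvalue.) -/
structure IsEigenbasis (A : H →ₗ.[ℝ] H) (φ : HilbertBasis ℕ ℝ H) (lam : ℕ → ℝ) : Prop where
  mono : Monotone lam
  eigen : ∀ n, ∃ h : φ n ∈ A.domain, A ⟨φ n, h⟩ = lam n • φ n

/-- The fractional power `A ^ s`, for the operator `A` with eigenbasis `φ` and eigenvalues `lam`:
`A ^ s x = ∑ lam n ^ s (x, φ n) φ n`, with domain `{x | ∑ |lam n ^ s (x, φ n)|² < ∞}`. -/
def fracPow (φ : HilbertBasis ℕ ℝ H) (lam : ℕ → ℝ) (s : ℝ) : H →ₗ.[ℝ] H where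
  domain :=
    { carrier := {x | Memℓp (fun n => lam n ^ s * ⟪φ n, x⟫_ℝ) 2}
      add_mem' := by
        intro x z hx hz
        have h := Memℓp.add hx hz
        refine (congrArg (fun f => Memℓp f 2) ?_).mp h
        funext n
        simp [inner_add_right, mul_add]
      zero_mem' := by
        refine (congrArg (fun f => Memℓp f 2) ?_).mp (zero_memℓp (E := fun _ : ℕ => ℝ) (p := 2))
        funext n
        simp
      smul_mem' := by
        intro c x hx
        have h := Memℓp.const_smul (𝕜 := ℝ) hx c
        refine (congrArg (fun f => Memℓp f 2) ?_).mp h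
        funext n
        simp [inner_smul_right]
        ring }
  toFun :=
    { toFun := fun x => φ.repr.symm ⟨fun n => lam n ^ s * ⟪φ n, (x : H)⟫_ℝ, x.2⟩
      map_add' := by
        intro x z
        rw [← map_add]
        congr 1
        ext n
        simp [inner_add_right, mul_add]
        rfl
      map_smul' := by
        intro c x
        rw [RingHom.id_apply, ← map_smul]
        congr 1
        ext n
        simp [inner_smul_right]
        ring }

/-- `y ∈ L²(I; D(S))`, where `D(S)` carries the graph norm of the closed operator `S`:
`y ∈ L²(I; H)`, `y t ∈ D(S)` for almost every `t ∈ I`, and `S y ∈ L²(I; H)`. -/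
def MemL2Domain (S : H →ₗ.[ℝ] H) (I : Set ℝ) (y : ℝ → H) : Prop :=
  MemLp y 2 (volume.restrict I) ∧
    ∃ g : ℝ → H, MemLp g 2 (volume.restrict I) ∧
      ∀ᵐ t ∂(volume.restrict I), (y t, g t) ∈ S.graph

/-- `y` is the (weak) solution on `[0, ∞)` of
`y' + A y + ∫₀ᵗ β (t - s) A y(s) ds = f`, `y(0) = y₀`: it is continuous with values in `H` and
`d/dt (y, w) + (y, A w) + ∫₀ᵗ β (t - s) (y(s), A w) ds = (f, w)` for every `w ∈ D(A)`. -/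
structure IsWeakSolution (A : H →ₗ.[ℝ] H) (β : ℝ → ℝ) (f : ℝ → H) (y₀ : H) (y : ℝ → H) :
    Prop where
  cont : ContinuousOn y (Ici 0)
  init : y 0 = y₀
  eqn : ∀ w : A.domain, ∀ t : ℝ, 0 < t →
    HasDerivAt (fun r => ⟪y r, (w : H)⟫_ℝ)
      (⟪f t, (w : H)⟫_ℝ - ⟪y t, A w⟫_ℝ - ∫ s in (0 : ℝ)..t, β (t - s) * ⟪y s, A w⟫_ℝ) t

/-- `y` is a classical solution on `[0, ∞)` of
`y' + A y + ∫₀ᵗ β (t - s) A y(s) ds = f`, `y(0) = y₀`: it is continuous with values in `D(A)`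
(graph norm), continuously differentiable with values in `H` when `f` is continuous,
and the equation holds in `H` for all `t ≥ 0`. -/
structure IsClassicalSolution (A : H →ₗ.[ℝ] H) (β : ℝ → ℝ) (f : ℝ → H) (y₀ : H) (y : ℝ → H) :
    Prop where
  init : y 0 = y₀
  eqn : ∃ z : ℝ → H, ContinuousOn z (Ici 0) ∧ ∀ t : ℝ, 0 ≤ t →
    (y t, z t) ∈ A.graph ∧
    HasDerivWithinAt y (f t - z t - ∫ s in (0 : ℝ)..t, β (t - s) • z s) (Ici 0) t

end Operator

section Spectrum

/-- `μ⁺ = (l + δ + √((l - δ)² - 4 l)) / 2`, with the principal complex square root. -/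
def muPlus (δ l : ℝ) : ℂ :=
  (1 / 2 : ℂ) * ((l : ℂ) + δ + (((l : ℂ) - δ) ^ 2 - 4 * l) ^ (1 / 2 : ℂ))

/-- `μ⁻ = (l + δ - √((l - δ)² - 4 l)) / 2`, with the principal complex square root. -/
def muMinus (δ l : ℝ) : ℂ :=
  (1 / 2 : ℂ) * ((l : ℂ) + δ - (((l : ℂ) - δ) ^ 2 - 4 * l) ^ (1 / 2 : ℂ))

/-- `N = max {N₁, N₂}`, where `N₁` and `N₂` are the largest (one-based) indices `j` with
`Re μⱼ⁺ ≤ γ`, respectively `Re μⱼ⁻ ≤ γ` (and `0` if there is none). Both index sets are finite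
when `lam → ∞` and `γ < δ + 1`. -/
def unstableDim (δ γ : ℝ) (lam : ℕ → ℝ) : ℕ :=
  max (sSup ((fun j : ℕ => j + 1) '' {j | (muPlus δ (lam j)).re ≤ γ}))
    (sSup ((fun j : ℕ => j + 1) '' {j | (muMinus δ (lam j)).re ≤ γ}))

/-- The indices `j < N` whose eigenvalue is that of index `k`. -/
abbrev EigenGroup (lam : ℕ → ℝ) (N : ℕ) (k : Fin N) : Type :=
  {j : Fin N // lam j = lam k}

/-- The largest multiplicity `M` among the eigenvalues `lam 0, …, lam (N - 1)`. -/
def maxMult (lam : ℕ → ℝ) (N : ℕ) : ℕ :=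
  Finset.univ.sup fun k : Fin N => Fintype.card (EigenGroup lam N k)

/-- The `2N × 2N` matrix `P = [[0, I], [-B_N, -A_N]]` with `A_N = diag (lam j + δ)` and
`B_N = diag (lam j (1 + δ))`. -/
def matP (δ : ℝ) (lam : ℕ → ℝ) (N : ℕ) : Matrix (Fin N ⊕ Fin N) (Fin N ⊕ Fin N) ℂ :=
  Matrix.fromBlocks 0 1
    (-Matrix.diagonal fun j : Fin N => ((lam j * (1 + δ) : ℝ) : ℂ))
    (-Matrix.diagonal fun j : Fin N => ((lam j + δ : ℝ) : ℂ))

/-- The `2N × M` matrix `Q = [0 ; C]` with `C j i = (B φ i, φ j)`. -/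
def matQ {H : Type*} [NormedAddCommGroup H] [InnerProductSpace ℝ H]
    (B : H →L[ℝ] H) (φ : HilbertBasis ℕ ℝ H) (N M : ℕ) :
    Matrix (Fin N ⊕ Fin N) (Fin M) ℂ :=
  Matrix.fromRows 0 (Matrix.of fun (j : Fin N) (i : Fin M) => ((⟪B (φ i), φ j⟫_ℝ : ℝ) : ℂ))

/-- The Jordan block of size `n` with eigenvalue `c`. -/
def jordanBlock (c : ℂ) (n : ℕ) : Matrix (Fin n) (Fin n) ℂ :=
  Matrix.of fun a b => if a = b then c else if (a : ℕ) + 1 = b then 1 else 0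

/-- `J` is, up to the numbering of the basis, a direct sum of Jordan blocks. -/
def IsJordanMatrix {ι : Type*} (J : Matrix ι ι ℂ) : Prop :=
  ∃ (b : ℕ) (n : Fin b → ℕ) (c : Fin b → ℂ) (e : (Σ i : Fin b, Fin (n i)) ≃ ι),
    J = Matrix.reindex e e (Matrix.blockDiagonal' fun i => jordanBlock (c i) (n i))

/-- The eigenvalues `-μⱼ⁺, -μⱼ⁻` (`j < N`) of `P` are semisimple: every generalized eigenvector is
an eigenvector. -/
def IsSemisimpleSpectrum (δ : ℝ) (lam : ℕ → ℝ) (N : ℕ) : Prop :=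
  ∀ j : Fin N, ∀ r : ℂ, r = -muPlus δ (lam j) ∨ r = -muMinus δ (lam j) →
    Module.End.maxGenEigenspace (Matrix.toLin' (matP δ lam N)) r =
      Module.End.eigenspace (Matrix.toLin' (matP δ lam N)) r

/-- The rank condition. `R` brings `P` to a Jordan form `J = R P R⁻¹` with diagonal
`-μ₁⁺, …, -μ_N⁺, -μ₁⁻, …, -μ_N⁻` (when the spectrum is semisimple `J` is this diagonal matrix).
With `Q̄ = R Q`, for each eigenvalue `lam k`, of multiplicity `m`, the `m` columns of `Q̄*` that
belong to the `μ⁺` of this eigenvalue have rank `m`, and so have the `m` columns that belong to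
its `μ⁻`. -/
def RankCondition {H : Type*} [NormedAddCommGroup H] [InnerProductSpace ℝ H]
    (δ : ℝ) (B : H →L[ℝ] H) (φ : HilbertBasis ℕ ℝ H) (lam : ℕ → ℝ) (N M : ℕ) : Prop :=
  ∃ R J : Matrix (Fin N ⊕ Fin N) (Fin N ⊕ Fin N) ℂ,
    IsUnit R.det ∧ matP δ lam N = R⁻¹ * J * R ∧ IsJordanMatrix J ∧
    (∀ j : Fin N, J (Sum.inl j) (Sum.inl j) = -muPlus δ (lam j)) ∧
    (∀ j : Fin N, J (Sum.inr j) (Sum.inr j) = -muMinus δ (lam j)) ∧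
    ∀ k : Fin N,
      ((R * matQ B φ N M).conjTranspose.submatrix id
        (fun j : EigenGroup lam N k => Sum.inl (j : Fin N))).rank
          = Fintype.card (EigenGroup lam N k) ∧
      ((R * matQ B φ N M).conjTranspose.submatrix id
        (fun j : EigenGroup lam N k => Sum.inr (j : Fin N))).rank
          = Fintype.card (EigenGroup lam N k)

end Spectrum

end PIDE

end

/-!
In the eigenbasis of `A` the equation decouples: with `z = β * y`, each coordinate `y` solves the
two-dimensional system `y' + λ (y + z) = f`, `z' = y - δ z`, whose characteristic polynomial
`X² + (λ + δ) X + λ (1 + δ)` has the roots `-μ⁺` and `-μ⁻`.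

The first `N` coordinates are steered to rest at time `2`, by smooth controls supported in `[1, 2]`:
the characteristic polynomials belonging to distinct eigenvalues are coprime, so Bezout's identity
allows to act on one eigenvalue without disturbing the others, and the rank condition says exactly
that the control matrix maps onto the coordinates belonging to each eigenvalue. All the remaining
coordinates decay at rate `γ` with a uniform constant: those with a large eigenvalue by an energy
estimate for `(y + z)² + (1 + δ) z²`, the finitely many others because `Re μ^± > γ`. The same
estimates dominate `λ y` and `λ z` by square summable sequences, which gives the regularity.
-/

noncomputable section

namespace PIDE

open Filter Topology
open scoped ContDiff

section Comparison

theorem norm_sub_le_of_norm_deriv_le {E : Type*} [NormedAddCommGroup E] [NormedSpace ℝ E]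
    {x x' : ℝ → E} {K K' : ℝ → ℝ} {a b : ℝ} (hab : a ≤ b)
    (hx : ContinuousOn x (Icc a b)) (hK : ContinuousOn K (Icc a b))
    (hx' : ∀ t ∈ Ioo a b, HasDerivAt x (x' t) t) (hK' : ∀ t ∈ Ioo a b, HasDerivAt K (K' t) t)
    (hle : ∀ t ∈ Ioo a b, ‖x' t‖ ≤ K' t) : ‖x b - x a‖ ≤ K b - K a := by
  obtain ⟨g, hg, hgx⟩ := exists_dual_vector'' ℝ (x b - x a)
  have hderiv : ∀ t ∈ Ioo a b, HasDerivAt (fun s => K s - g (x s)) (K' t - g (x' t)) t :=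
    fun t ht => (hK' t ht).sub (g.hasFDerivAt.comp_hasDerivAt t (hx' t ht))
  have hmono : MonotoneOn (fun s => K s - g (x s)) (Icc a b) := by
    refine monotoneOn_of_hasDerivWithinAt_nonneg (convex_Icc a b)
      (hK.sub (g.continuous.comp_continuousOn hx)) (f' := fun t => K' t - g (x' t))
      (fun t ht => (hderiv t (interior_Icc.subset ht)).hasDerivWithinAt) fun t ht => ?_
    have hgx' : g (x' t) ≤ 1 * ‖x' t‖ := (le_abs_self _).trans (g.le_of_opNorm_le hg (x' t))
    linarith [hle t (interior_Icc.subset ht)]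
  have hends : K a - g (x a) ≤ K b - g (x b) :=
    hmono (left_mem_Icc.2 hab) (right_mem_Icc.2 hab) hab
  have hnorm : g (x b) - g (x a) = ‖x b - x a‖ := (map_sub g _ _).symm.trans hgx
  linarith

theorem norm_le_of_supersolution {μ : ℂ} {x g : ℝ → ℂ} {K K' : ℝ → ℝ}
    (hx : ContinuousOn x (Ici 0)) (hK : ContinuousOn K (Ici 0))
    (hx' : ∀ t, 0 < t → HasDerivAt x (g t - μ * x t) t)
    (hK' : ∀ t, 0 < t → HasDerivAt K (K' t) t)
    (hg : ∀ t, 0 < t → ‖g t‖ ≤ K' t + μ.re * K t) (h0 : ‖x 0‖ ≤ K 0) {t : ℝ} (ht : 0 ≤ t) :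
    ‖x t‖ ≤ K t := by
  have hexp : ∀ s : ℝ, HasDerivAt (fun s : ℝ => Complex.exp (μ * s)) (Complex.exp (μ * s) * μ) s :=
    fun s => by simpa using ((Complex.ofRealCLM.hasDerivAt (x := s)).const_mul μ).cexp
  have hnorm : ∀ s : ℝ, ‖Complex.exp (μ * s)‖ = Real.exp (μ.re * s) := fun s => by
    simp [Complex.norm_exp]
  have hx := hx.mono (Icc_subset_Ici_self : Icc 0 t ⊆ Ici 0)
  have hK := hK.mono (Icc_subset_Ici_self : Icc 0 t ⊆ Ici 0)
  have hdiff := norm_sub_le_of_norm_deriv_le ht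
    (x := fun s => Complex.exp (μ * s) * x s) (x' := fun s => Complex.exp (μ * s) * g s)
    (K := fun s => Real.exp (μ.re * s) * K s)
    (K' := fun s => Real.exp (μ.re * s) * (K' s + μ.re * K s)) (by fun_prop) (by fun_prop)
    (fun s hs => ((hexp s).mul (hx' s hs.1)).congr_deriv (by ring))
    (fun s hs => ((((hasDerivAt_id s).const_mul μ.re).exp).mul (hK' s hs.1)).congr_deriv
      (by simp only [id]; ring))
    (fun s hs => by
      rw [norm_mul, hnorm]
      exact mul_le_mul_of_nonneg_left (hg s hs.1) (Real.exp_nonneg _))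
  have hweighted : Real.exp (μ.re * t) * ‖x t‖ ≤ Real.exp (μ.re * t) * K t := by
    have htri := norm_sub_norm_le (Complex.exp (μ * t) * x t) (Complex.exp (μ * (0 : ℝ)) * x 0)
    simp only [Complex.ofReal_zero, mul_zero, Complex.exp_zero, Real.exp_zero, one_mul, norm_mul,
      hnorm] at hdiff htri
    linarith
  exact le_of_mul_le_mul_left hweighted (Real.exp_pos _)

theorem abs_le_of_supersolution {m : ℝ} {x g K K' : ℝ → ℝ}
    (hx : ContinuousOn x (Ici 0)) (hK : ContinuousOn K (Ici 0))
    (hx' : ∀ t, 0 < t → HasDerivAt x (g t - m * x t) t)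
    (hK' : ∀ t, 0 < t → HasDerivAt K (K' t) t)
    (hg : ∀ t, 0 < t → |g t| ≤ K' t + m * K t) (h0 : |x 0| ≤ K 0) {t : ℝ} (ht : 0 ≤ t) :
    |x t| ≤ K t := by
  simpa using norm_le_of_supersolution (μ := m) (x := fun t => (x t : ℂ)) (g := fun t => (g t : ℂ))
    (Complex.continuous_ofReal.comp_continuousOn hx) hK
    (fun t ht => by simpa using (hx' t ht).ofReal_comp) hK' (fun t ht => by simpa using hg t ht)
    (by simpa using h0) ht

theorem hasDerivAt_const_mul_exp (D c t : ℝ) :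
    HasDerivAt (fun t => D * Real.exp (c * t)) (c * (D * Real.exp (c * t))) t :=
  (((hasDerivAt_id t).const_mul c).exp.const_mul D).congr_deriv (by simp only [id]; ring)

theorem norm_le_mul_exp {μ : ℂ} {ρ D : ℝ} {x g : ℝ → ℂ} (hx : ContinuousOn x (Ici 0))
    (hx' : ∀ t, 0 < t → HasDerivAt x (g t - μ * x t) t)
    (hg : ∀ t, 0 < t → ‖g t‖ ≤ (μ.re - ρ) * (D * Real.exp (-ρ * t))) (h0 : ‖x 0‖ ≤ D) {t : ℝ}
    (ht : 0 ≤ t) : ‖x t‖ ≤ D * Real.exp (-ρ * t) :=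
  norm_le_of_supersolution hx (by fun_prop) hx' (fun s _ => hasDerivAt_const_mul_exp D (-ρ) s)
    (fun s hs => (hg s hs).trans_eq (by ring)) (by simpa using h0) ht

end Comparison

section Mode

/-- The two-dimensional system of a single eigenmode: `y' + l (y + z) = f` and `z' = y - δ z`,
with `y 0 = a` and `z 0 = 0`, so that `z` is the convolution of `y` with `exp (-δ t)`. -/
structure IsMode (δ l : ℝ) (f : ℝ → ℝ) (a : ℝ) (y z : ℝ → ℝ) : Prop where
  init_fst : y 0 = a
  init_snd : z 0 = 0
  continuousOn_fst : ContinuousOn y (Ici 0)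
  continuousOn_snd : ContinuousOn z (Ici 0)
  hasDerivAt_fst : ∀ t, 0 < t → HasDerivAt y (f t - l * (y t + z t)) t
  hasDerivAt_snd : ∀ t, 0 < t → HasDerivAt z (y t - δ * z t) t

theorem nonneg_of_forcing_le {f : ℝ → ℝ} {V r : ℝ}
    (hf : ∀ t, 0 < t → |f t| ≤ V * Real.exp (r * t)) : 0 ≤ V :=
  nonneg_of_mul_nonneg_left ((abs_nonneg _).trans (hf 1 one_pos)) (Real.exp_pos _)

theorem abs_le_of_energy_le {w z S δ : ℝ} (hδ : 0 ≤ δ) (hS : 0 ≤ S)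
    (h : w ^ 2 + (1 + δ) * z ^ 2 ≤ S ^ 2) : |w| ≤ S ∧ |z| ≤ S := by
  have := mul_nonneg hδ (sq_nonneg z)
  constructor <;> refine abs_le_of_sq_le_sq ?_ hS <;> nlinarith [sq_nonneg w, sq_nonneg z]

namespace IsMode

variable {δ γ l a V t : ℝ} {f y z : ℝ → ℝ}

theorem sub {f' y' z' : ℝ → ℝ} {a' : ℝ} (h : IsMode δ l f a y z) (h' : IsMode δ l f' a' y' z') :
    IsMode δ l (f - f') (a - a') (y - y') (z - z') where
  init_fst := by simp [h.init_fst, h'.init_fst]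
  init_snd := by simp [h.init_snd, h'.init_snd]
  continuousOn_fst := h.continuousOn_fst.sub h'.continuousOn_fst
  continuousOn_snd := h.continuousOn_snd.sub h'.continuousOn_snd
  hasDerivAt_fst t ht := ((h.hasDerivAt_fst t ht).sub (h'.hasDerivAt_fst t ht)).congr_deriv
    (by simp only [Pi.sub_apply]; ring)
  hasDerivAt_snd t ht := ((h.hasDerivAt_snd t ht).sub (h'.hasDerivAt_snd t ht)).congr_deriv
    (by simp only [Pi.sub_apply]; ring)

theorem continuousOn_energy (h : IsMode δ l f a y z) :
    ContinuousOn (fun t => (y t + z t) ^ 2 + (1 + δ) * z t ^ 2) (Ici 0) :=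
  ((h.continuousOn_fst.add h.continuousOn_snd).pow 2).add
    (continuousOn_const.mul (h.continuousOn_snd.pow 2))

-- The weight `1 + δ` is the one for which the mixed terms `(y + z) z` cancel.
theorem hasDerivAt_energy (h : IsMode δ l f a y z) (ht : 0 < t) :
    HasDerivAt (fun t => (y t + z t) ^ 2 + (1 + δ) * z t ^ 2)
      (2 * (y t + z t) * f t - 2 * (l - 1) * (y t + z t) ^ 2 - 2 * (1 + δ) ^ 2 * z t ^ 2) t := by
  have hy := h.hasDerivAt_fst t ht
  have hz := h.hasDerivAt_snd t ht
  refine (((hy.add hz).pow 2).add ((hz.pow 2).const_mul (1 + δ))).congr_deriv ?_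
  simp only [Pi.add_apply]
  ring

theorem energy_le_of_supersolution {K K' : ℝ → ℝ} (h : IsMode δ l f a y z) (hδ : 0 ≤ 1 + δ)
    (hγ : γ ≤ δ + 1) (hl : γ + 2 ≤ l) (hK : ContinuousOn K (Ici 0))
    (hK' : ∀ t, 0 < t → HasDerivAt K (K' t) t)
    (hf : ∀ t, 0 < t → f t ^ 2 ≤ K' t + 2 * γ * K t) (h0 : a ^ 2 ≤ K 0) (ht : 0 ≤ t) :
    (y t + z t) ^ 2 + (1 + δ) * z t ^ 2 ≤ K t := by
  set e : ℝ → ℝ := fun t => (y t + z t) ^ 2 + (1 + δ) * z t ^ 2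
  have hmono : MonotoneOn (fun t => Real.exp (2 * γ * t) * (K t - e t)) (Ici 0) := by
    refine monotoneOn_of_hasDerivWithinAt_nonneg (convex_Ici 0)
      (Continuous.continuousOn (by fun_prop) |>.mul (hK.sub h.continuousOn_energy)) (fun s hs =>
      (((hasDerivAt_id s).const_mul (2 * γ)).exp.mul ((hK' s (interior_Ici.subset hs)).sub
        (h.hasDerivAt_energy (interior_Ici.subset hs)))).hasDerivWithinAt) fun s hs => ?_
    have hdamp : 0 ≤ (l - γ - 2) * (y s + z s) ^ 2 + (1 + δ) * (δ + 1 - γ) * z s ^ 2 :=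
      add_nonneg (mul_nonneg (by linarith) (sq_nonneg _))
        (mul_nonneg (mul_nonneg hδ (by linarith)) (sq_nonneg _))
    have hyoung : 2 * (y s + z s) * f s ≤ (y s + z s) ^ 2 + f s ^ 2 :=
      two_mul_le_add_sq (y s + z s) (f s)
    have hrate : 0 ≤ 2 * γ * (K s - e s) + (K' s - (2 * (y s + z s) * f s
        - 2 * (l - 1) * (y s + z s) ^ 2 - 2 * (1 + δ) ^ 2 * z s ^ 2)) := by
      simp only [e]
      linarith [hf s (interior_Ici.subset hs), sq_nonneg (y s + z s)]
    refine (mul_nonneg (Real.exp_nonneg (2 * γ * s)) hrate).trans_eq ?_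
    simp only [id, Pi.sub_apply]
    ring
  have hstart : 0 ≤ Real.exp (2 * γ * 0) * (K 0 - e 0) := by
    simpa [e, h.init_fst, h.init_snd] using h0
  have hend : 0 ≤ Real.exp (2 * γ * t) * (K t - e t) :=
    hstart.trans (hmono self_mem_Ici ht ht)
  exact sub_nonneg.1 (nonneg_of_mul_nonneg_right hend (Real.exp_pos _))

theorem eq_of_eq_data {y' z' : ℝ → ℝ} (hδ : 0 < 1 + δ) (h : IsMode δ l f a y z)
    (h' : IsMode δ l f a y' z') (ht : 0 ≤ t) : y t = y' t ∧ z t = z' t := by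
  have henergy := (h.sub h').energy_le_of_supersolution (K := 0) (K' := 0)
    (γ := min (l - 2) (δ + 1)) hδ.le (min_le_right _ _) (by linarith [min_le_left (l - 2) (δ + 1)])
    continuousOn_const (fun t _ => hasDerivAt_const t 0) (by simp) (by simp) ht
  simp only [Pi.sub_apply, Pi.zero_apply] at henergy
  have hz : z t - z' t = 0 := pow_eq_zero_iff two_ne_zero |>.1 <| by
    nlinarith [sq_nonneg (y t - y' t + (z t - z' t)), sq_nonneg (z t - z' t)]
  rw [hz] at henergy
  exact ⟨sub_eq_zero.1 (by nlinarith), sub_eq_zero.1 hz⟩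

theorem abs_le_of_forcing_bounded (h : IsMode δ l f a y z) (hδ : 0 ≤ δ) (hl : 3 ≤ l)
    (hf : ∀ t, 0 < t → |f t| ≤ V) (ht : 0 ≤ t) : |y t + z t| ≤ |a| + V ∧ |z t| ≤ |a| + V := by
  have hV : 0 ≤ V := (abs_nonneg _).trans (hf 1 one_pos)
  refine abs_le_of_energy_le hδ (by positivity) ?_
  refine (h.energy_le_of_supersolution (γ := 1 / 2) (K := fun _ => a ^ 2 + V ^ 2) (by linarith)
    (by linarith) (by linarith) continuousOn_const (fun t _ => hasDerivAt_const t _)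
    (fun t ht => ?_) (by nlinarith) ht).trans ?_
  · nlinarith [sq_le_sq' (abs_le.1 (hf t ht)).1 (abs_le.1 (hf t ht)).2]
  · nlinarith [sq_abs a, mul_nonneg (abs_nonneg a) hV]

theorem abs_le_mul_exp_of_le (h : IsMode δ l f a y z) (hδ : 0 ≤ δ) (hγ : γ ≤ δ + 1) (hl : γ + 2 ≤ l)
    (hf : ∀ t, 0 < t → |f t| ≤ V * Real.exp (-(γ + 1) * t)) (ht : 0 ≤ t) :
    |y t| ≤ 2 * ((|a| + V) * Real.exp (-γ * t)) := by
  have hV : 0 ≤ V := nonneg_of_forcing_le hf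
  have hexp : ∀ c : ℝ, Real.exp (-(2 * c) * t) = Real.exp (-c * t) ^ 2 := fun c => by
    rw [← Real.exp_nat_mul]; ring_nf
  have henergy := h.energy_le_of_supersolution (by linarith) hγ hl
    (K := fun t => (a ^ 2 + V ^ 2 / 2) * Real.exp (-(2 * γ) * t)
      - V ^ 2 / 2 * Real.exp (-(2 * (γ + 1)) * t)) (by fun_prop)
    (fun t _ => (hasDerivAt_const_mul_exp _ _ t).sub (hasDerivAt_const_mul_exp _ _ t))
    (fun t ht => by
      have := pow_le_pow_left₀ (abs_nonneg _) (hf t ht) 2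
      rw [sq_abs, mul_pow, ← Real.exp_nat_mul] at this
      refine this.trans_eq ?_
      push_cast
      ring_nf)
    (by simp) ht
  obtain ⟨hw, hz⟩ := abs_le_of_energy_le hδ (S := (|a| + V) * Real.exp (-γ * t)) (by positivity)
    (henergy.trans <| by
      have hcross : 0 ≤ (2 * (|a| * V) + V ^ 2 / 2) * Real.exp (-γ * t) ^ 2 := by positivity
      have hsub : 0 ≤ V ^ 2 / 2 * Real.exp (-(2 * (γ + 1)) * t) := by positivity
      rw [hexp γ, ← sq_abs a]
      linarith)
  have htri := abs_sub (y t + z t) (z t)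
  rw [add_sub_cancel_right] at htri
  linarith

theorem hasDerivAt_fst_add_snd (h : IsMode δ l f a y z) (ht : 0 < t) :
    HasDerivAt (fun t => y t + z t) (f t - (1 + δ) * z t - (l - 1) * (y t + z t)) t :=
  ((h.hasDerivAt_fst t ht).add (h.hasDerivAt_snd t ht)).congr_deriv (by ring)

theorem abs_fst_add_snd_le (h : IsMode δ l f a y z) (hδ : 0 ≤ δ) (hl : 3 ≤ l)
    (hf : ∀ t, 0 < t → |f t| ≤ V) (ht : 0 ≤ t) :
    |y t + z t| ≤ |a| * Real.exp (-(l - 1) * t) + (2 + δ) * (|a| + V) / (l - 1) := by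
  have hl1 : 0 < l - 1 := by linarith
  have hV : 0 ≤ V := (abs_nonneg _).trans (hf 1 one_pos)
  refine abs_le_of_supersolution (x := fun t => y t + z t)
    (K := fun t => |a| * Real.exp (-(l - 1) * t) + (2 + δ) * (|a| + V) / (l - 1))
    (h.continuousOn_fst.add h.continuousOn_snd) (by fun_prop)
    (fun s hs => h.hasDerivAt_fst_add_snd hs)
    (fun s _ => (hasDerivAt_const_mul_exp _ _ s).add_const _) (fun s hs => ?_) ?_ ht
  · have hz : |(1 + δ) * z s| ≤ (1 + δ) * (|a| + V) := by
      rw [abs_mul, abs_of_nonneg (by linarith : 0 ≤ 1 + δ)]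
      exact mul_le_mul_of_nonneg_left (h.abs_le_of_forcing_bounded hδ hl hf hs.le).2 (by linarith)
    calc |f s - (1 + δ) * z s| ≤ V + (1 + δ) * (|a| + V) :=
          (abs_sub _ _).trans (add_le_add (hf s hs) hz)
      _ ≤ (2 + δ) * (|a| + V) := by linarith [abs_nonneg a]
      _ = _ := by field_simp; ring
  · have : 0 ≤ (2 + δ) * (|a| + V) / (l - 1) := by positivity
    simpa [h.init_fst, h.init_snd] using this

theorem mul_abs_snd_le (h : IsMode δ l f a y z) (hδ : 0 ≤ δ) (hl : 3 ≤ l)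
    (hf : ∀ t, 0 < t → |f t| ≤ V) (ht : 0 ≤ t) : l * |z t| ≤ 2 * (3 + δ) * (|a| + V) := by
  have hl1 : 0 < l - 1 := by linarith
  have hV : 0 ≤ V := (abs_nonneg _).trans (hf 1 one_pos)
  have hz : |z t| ≤ (|a| - |a| * Real.exp (-(l - 1) * t)
      + (2 + δ) * (|a| + V) / (1 + δ)) / (l - 1) := by
    refine abs_le_of_supersolution (K := fun t => (|a| - |a| * Real.exp (-(l - 1) * t)
        + (2 + δ) * (|a| + V) / (1 + δ)) / (l - 1))
      (K' := fun t => |a| * Real.exp (-(l - 1) * t)) (m := 1 + δ) (g := fun t => y t + z t)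
      h.continuousOn_snd (by fun_prop) (fun s hs => (h.hasDerivAt_snd s hs).congr_deriv (by ring))
      (fun s _ => ((((hasDerivAt_const_mul_exp _ _ s).const_sub _).add_const _).div_const
        _).congr_deriv (by field_simp)) (fun s hs => ?_) ?_ ht
    · refine (h.abs_fst_add_snd_le hδ hl hf hs.le).trans ?_
      have : 0 ≤ (1 + δ) * (|a| - |a| * Real.exp (-(l - 1) * s)) / (l - 1) := by
        have : Real.exp (-(l - 1) * s) ≤ 1 := Real.exp_le_one_iff.2 (by nlinarith)
        exact div_nonneg (mul_nonneg (by linarith) (by nlinarith [abs_nonneg a])) hl1.le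
      have hsplit : (1 + δ) * ((|a| - |a| * Real.exp (-(l - 1) * s)
          + (2 + δ) * (|a| + V) / (1 + δ)) / (l - 1))
          = (1 + δ) * (|a| - |a| * Real.exp (-(l - 1) * s)) / (l - 1)
            + (2 + δ) * (|a| + V) / (l - 1) := by field_simp
      linarith
    · have : 0 ≤ (2 + δ) * (|a| + V) / (1 + δ) / (l - 1) := by positivity
      simpa [h.init_snd] using this
  have hquot : (2 + δ) * (|a| + V) / (1 + δ) ≤ (2 + δ) * (|a| + V) :=
    div_le_self (by positivity) (by linarith)
  rw [le_div_iff₀ hl1] at hz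
  nlinarith [abs_nonneg (z t), mul_nonneg (abs_nonneg a) (Real.exp_nonneg (-(l - 1) * t))]

theorem mul_abs_fst_le (h : IsMode δ l f a y z) (hδ : 0 ≤ δ) (hl : 3 ≤ l)
    (hf : ∀ t, 0 < t → |f t| ≤ V) (ht : 0 ≤ t) :
    l * |y t| ≤ l * Real.exp (-(l - 1) * t) * |a| + (10 + 4 * δ) * (|a| + V) := by
  have hl1 : 0 < l - 1 := by linarith
  have hV : 0 ≤ V := (abs_nonneg _).trans (hf 1 one_pos)
  have hw : l * |y t + z t| ≤ l * Real.exp (-(l - 1) * t) * |a| + 2 * (2 + δ) * (|a| + V) := by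
    have hquot : l * ((2 + δ) * (|a| + V) / (l - 1)) ≤ 2 * (2 + δ) * (|a| + V) := by
      rw [← mul_div_assoc, div_le_iff₀ hl1]
      nlinarith [mul_nonneg (by linarith : 0 ≤ 2 + δ) (add_nonneg (abs_nonneg a) hV)]
    have := mul_le_mul_of_nonneg_left (h.abs_fst_add_snd_le hδ hl hf ht) (by linarith : 0 ≤ l)
    linarith
  have htri := abs_sub (y t + z t) (z t)
  rw [add_sub_cancel_right] at htri
  have := mul_le_mul_of_nonneg_left htri (by linarith : 0 ≤ l)
  linarith [h.mul_abs_snd_le hδ hl hf ht]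

theorem integral_mul_sq_le {T : ℝ} (h : IsMode δ l f a y z) (hδ : 0 ≤ δ) (hl : 3 ≤ l)
    (hf : ∀ t, 0 < t → |f t| ≤ V) (hT : 0 ≤ T) :
    ∫ t in (0 : ℝ)..T, l * y t ^ 2 ≤ (2 + (14 + 4 * δ) * T) * (|a| + V) ^ 2 := by
  have hV : 0 ≤ V := (abs_nonneg _).trans (hf 1 one_pos)
  set c := 2 * V ^ 2 + 4 * (3 + δ) * (|a| + V) ^ 2
  have hbound := intervalIntegral.integral_le_sub_of_hasDeriv_right_of_le hT
    (g := fun t => c * t - 2 * ((y t + z t) ^ 2 + (1 + δ) * z t ^ 2))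
    (g' := fun t => c - 2 * (2 * (y t + z t) * f t - 2 * (l - 1) * (y t + z t) ^ 2
      - 2 * (1 + δ) ^ 2 * z t ^ 2)) (φ := fun t => l * y t ^ 2)
    (((continuous_const.mul continuous_id).continuousOn.sub
      (continuousOn_const.mul h.continuousOn_energy)).mono Icc_subset_Ici_self)
    (fun t ht => ((((hasDerivAt_id t).const_mul c).congr_deriv (mul_one c)).sub
      ((h.hasDerivAt_energy ht.1).const_mul 2)).hasDerivWithinAt)
    ((continuousOn_const.mul (h.continuousOn_fst.pow 2)).mono
      Icc_subset_Ici_self).integrableOn_Icc fun t ht => by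
      have hz : 2 * (l * z t ^ 2) ≤ 4 * (3 + δ) * (|a| + V) ^ 2 := by
        have := mul_le_mul (h.mul_abs_snd_le hδ hl hf ht.1.le)
          (h.abs_le_of_forcing_bounded hδ hl hf ht.1.le).2 (abs_nonneg _) (by positivity)
        rw [← sq_abs (z t)]
        linarith
      have hforce : 2 * (y t + z t) * f t ≤ (y t + z t) ^ 2 + V ^ 2 :=
        (two_mul_le_add_sq _ _).trans (by
          gcongr _ + ?_; exact sq_le_sq' (abs_le.1 (hf t ht.1)).1 (abs_le.1 (hf t ht.1)).2)
      have hsplit : l * y t ^ 2 ≤ 2 * l * (y t + z t) ^ 2 + 2 * (l * z t ^ 2) := by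
        nlinarith [mul_nonneg (by linarith : 0 ≤ l) (sq_nonneg (y t + 2 * z t))]
      have hslack : 0 ≤ (l - 3) * (y t + z t) ^ 2 + 2 * (1 + δ) ^ 2 * z t ^ 2 :=
        add_nonneg (mul_nonneg (by linarith) (sq_nonneg _)) (by positivity)
      simp only [c]
      linarith
  simp only [h.init_fst, h.init_snd] at hbound
  have henergy : 0 ≤ (y T + z T) ^ 2 + (1 + δ) * z T ^ 2 := by positivity
  have hsq : V ^ 2 ≤ (|a| + V) ^ 2 ∧ a ^ 2 ≤ (|a| + V) ^ 2 := by
    rw [← sq_abs a]; constructor <;> gcongr <;> linarith [abs_nonneg a]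
  have hcT : c * T ≤ (14 + 4 * δ) * T * (|a| + V) ^ 2 := by
    simp only [c]; nlinarith
  linarith [hsq.2]

end IsMode

end Mode

section CharacteristicExponents

variable {δ γ l : ℝ}

theorem muPlus_add_muMinus (δ l : ℝ) : muPlus δ l + muMinus δ l = l + δ := by
  unfold muPlus muMinus; ring

theorem muPlus_mul_muMinus (δ l : ℝ) : muPlus δ l * muMinus δ l = l * (1 + δ) := by
  have hsqrt : ((((l : ℂ) - δ) ^ 2 - 4 * l) ^ (1 / 2 : ℂ)) ^ 2 = ((l : ℂ) - δ) ^ 2 - 4 * l := by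
    simp [one_div]
  unfold muPlus muMinus
  linear_combination (-1 / 4 : ℂ) * hsqrt

theorem muPlus_isRoot (δ l : ℝ) : muPlus δ l ^ 2 - (l + δ) * muPlus δ l + l * (1 + δ) = 0 := by
  linear_combination (muPlus δ l) * muPlus_add_muMinus δ l - muPlus_mul_muMinus δ l

theorem muMinus_isRoot (δ l : ℝ) : muMinus δ l ^ 2 - (l + δ) * muMinus δ l + l * (1 + δ) = 0 := by
  linear_combination (muMinus δ l) * muPlus_add_muMinus δ l - muPlus_mul_muMinus δ l

theorem lt_re_of_isRoot (hδ : 0 < 1 + δ) (hγ : γ < δ + 1) (hl : γ + 1 ≤ l) {μ : ℂ}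
    (h : μ ^ 2 - (l + δ) * μ + l * (1 + δ) = 0) : γ < μ.re := by
  by_contra! hx
  have hre := congrArg Complex.re h
  have him := congrArg Complex.im h
  simp only [pow_two, Complex.add_re, Complex.sub_re, Complex.mul_re, Complex.ofReal_re,
    Complex.ofReal_im, Complex.add_im, Complex.one_re, Complex.one_im, Complex.zero_re,
    Complex.sub_im, Complex.mul_im, Complex.zero_im] at hre him
  set x := μ.re
  set v := μ.im
  -- The real part of `(μ - (l - 1)) (1 + δ - μ) = 1 + δ`, times the conjugate of `1 + δ - μ`.
  have hid : (x - (l - 1)) * ((1 + δ - x) ^ 2 + v ^ 2) = (1 + δ) * (1 + δ - x) := by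
    linear_combination (-(1 + δ - x)) * hre + v * him
  have hpos : 0 < (1 + δ) * (1 + δ - x) := mul_pos hδ (by linarith)
  have hneg : (x - (l - 1)) * ((1 + δ - x) ^ 2 + v ^ 2) ≤ 0 :=
    mul_nonpos_of_nonpos_of_nonneg (by linarith) (by positivity)
  linarith

theorem lt_re_of_sSup_le (hδ : 0 < 1 + δ) (hγ : γ < δ + 1) {lam : ℕ → ℝ}
    (hlam : Tendsto lam atTop atTop) {μ : ℝ → ℂ}
    (hμ : ∀ l : ℝ, μ l ^ 2 - (l + δ) * μ l + l * (1 + δ) = 0) {n : ℕ}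
    (hn : sSup ((fun j : ℕ => j + 1) '' {j | (μ (lam j)).re ≤ γ}) ≤ n) : γ < (μ (lam n)).re := by
  obtain ⟨J, hJ⟩ := eventually_atTop.1 (hlam.eventually_ge_atTop (γ + 1))
  have hbdd : BddAbove ((fun j : ℕ => j + 1) '' {j | (μ (lam j)).re ≤ γ}) := by
    refine ⟨J, ?_⟩
    rintro _ ⟨j, hj : (μ (lam j)).re ≤ γ, rfl⟩
    by_contra! hlt
    exact hj.not_gt (lt_re_of_isRoot hδ hγ (hJ j (Nat.lt_succ_iff.1 hlt)) (hμ _))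
  by_contra! hle
  exact absurd ((le_csSup hbdd ⟨n, hle, rfl⟩).trans hn) (Nat.not_succ_le_self n)

theorem lt_re_of_unstableDim_le (hδ : 0 < 1 + δ) (hγ : γ < δ + 1) {lam : ℕ → ℝ}
    (hlam : Tendsto lam atTop atTop) {n : ℕ} (hn : unstableDim δ γ lam ≤ n) :
    γ < (muPlus δ (lam n)).re ∧ γ < (muMinus δ (lam n)).re :=
  ⟨lt_re_of_sSup_le hδ hγ hlam (muPlus_isRoot δ) ((le_max_left _ _).trans hn),
    lt_re_of_sSup_le hδ hγ hlam (muMinus_isRoot δ) ((le_max_right _ _).trans hn)⟩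

theorem exists_hasDerivAt_firstOrder (μ x₀ : ℂ) {g : ℝ → ℂ} (hg : Continuous g) :
    ∃ x : ℝ → ℂ, x 0 = x₀ ∧ ∀ t, HasDerivAt x (g t - μ * x t) t := by
  refine ⟨fun t => Complex.exp (-(μ * t)) * (x₀ + ∫ s in (0 : ℝ)..t, Complex.exp (μ * s) * g s),
    by simp, fun t => ?_⟩
  have hcont : Continuous fun s : ℝ => Complex.exp (μ * s) * g s := by fun_prop
  have hint := (hcont.integral_hasStrictDerivAt 0 t).hasDerivAt.const_add x₀
  have hexp : HasDerivAt (fun t : ℝ => Complex.exp (-(μ * t)))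
      (Complex.exp (-(μ * t)) * (-(μ * 1))) t :=
    ((Complex.ofRealCLM.hasDerivAt (x := t)).const_mul μ).neg.cexp
  have hinv : Complex.exp (-(μ * t)) * Complex.exp (μ * t) = 1 := by
    rw [← Complex.exp_add, neg_add_cancel, Complex.exp_zero]
  exact (hexp.mul hint).congr_deriv (by linear_combination (g t) * hinv)

-- With `p' = f - μ⁻ p` and `q' = p - μ⁺ q`, the mode is `z = Re q`, `y = z' + δ z`.
theorem exists_hasDerivAt_mode (δ l : ℝ) {f : ℝ → ℝ} (hf : Continuous f) (a : ℝ) :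
    ∃ y z : ℝ → ℝ, y 0 = a ∧ z 0 = 0 ∧ (∀ t, HasDerivAt y (f t - l * (y t + z t)) t) ∧
      ∀ t, HasDerivAt z (y t - δ * z t) t := by
  obtain ⟨p, hp0, hp⟩ :=
    exists_hasDerivAt_firstOrder (muMinus δ l) a (g := fun t => (f t : ℂ)) (by fun_prop)
  obtain ⟨q, hq0, hq⟩ := exists_hasDerivAt_firstOrder (muPlus δ l) 0
    (continuous_iff_continuousAt.2 fun t => (hp t).continuousAt)
  have hre : ∀ {u : ℝ → ℂ} {u' : ℂ} {t : ℝ}, HasDerivAt u u' t →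
      HasDerivAt (fun t => (u t).re) u'.re t := fun {u u' t} h =>
    Complex.reCLM.hasFDerivAt.comp_hasDerivAt t h
  refine ⟨fun t => (p t + (δ - muPlus δ l) * q t).re, fun t => (q t).re, by simp [hp0, hq0],
    by simp [hq0], fun t => ?_, fun t => ?_⟩
  · have hrhs : (f t : ℂ) - muMinus δ l * p t + (δ - muPlus δ l) * (p t - muPlus δ l * q t)
        = (f t : ℂ) - l * (p t + (δ - muPlus δ l) * q t + q t) := by
      linear_combination (-p t) * muPlus_add_muMinus δ l + (q t) * muPlus_isRoot δ l
    exact (hre ((hp t).add ((hq t).const_mul (δ - muPlus δ l)))).congr_deriv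
      (by rw [hrhs]; simp)
  · have hrhs : p t - muPlus δ l * q t = (p t + (δ - muPlus δ l) * q t) - δ * q t := by ring
    exact (hre (hq t)).congr_deriv (by rw [hrhs]; simp)

theorem exists_isMode (δ l : ℝ) {f : ℝ → ℝ} (hf : Continuous f) (a : ℝ) :
    ∃ y z : ℝ → ℝ, IsMode δ l f a y z := by
  obtain ⟨y, z, hy0, hz0, hy, hz⟩ := exists_hasDerivAt_mode δ l hf a
  exact ⟨y, z, hy0, hz0, fun t _ => (hy t).continuousAt.continuousWithinAt,
    fun t _ => (hz t).continuousAt.continuousWithinAt, fun t _ => hy t, fun t _ => hz t⟩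

variable {a V t : ℝ} {f y z : ℝ → ℝ}

-- `u = y + (μ⁺ - δ) z`, that is `z' + μ⁺ z`, solves `u' = f - μ⁻ u`, so that the mode decays by two
-- successive first order comparisons.
theorem IsMode.hasDerivAt_fst_add_mul_snd (h : IsMode δ l f a y z) (ht : 0 < t) :
    HasDerivAt (fun t => (y t + (muPlus δ l - δ) * z t : ℂ))
      (f t - muMinus δ l * (y t + (muPlus δ l - δ) * z t)) t := by
  have hy := (h.hasDerivAt_fst t ht).ofReal_comp
  have hz := (h.hasDerivAt_snd t ht).ofReal_comp
  refine (hy.add (hz.const_mul (muPlus δ l - δ))).congr_deriv ?_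
  push_cast
  linear_combination (y t + (muPlus δ l - δ) * z t) * muPlus_add_muMinus δ l
    - (z t : ℂ) * muPlus_isRoot δ l

theorem IsMode.norm_fst_add_mul_snd_le (h : IsMode δ l f a y z) (hm : γ < (muMinus δ l).re)
    (hf : ∀ t, 0 < t → |f t| ≤ V * Real.exp (-γ * t)) (ht : 0 ≤ t) :
    ‖(y t + (muPlus δ l - δ) * z t : ℂ)‖
      ≤ (|a| + V / ((muMinus δ l).re - γ)) * Real.exp (-γ * t) := by
  have hV : 0 ≤ V := nonneg_of_forcing_le hf
  have hm' : 0 < (muMinus δ l).re - γ := sub_pos.2 hm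
  refine norm_le_mul_exp (μ := muMinus δ l) (x := fun t => y t + (muPlus δ l - δ) * z t)
    (g := fun t => (f t : ℂ))
    ((Complex.continuous_ofReal.comp_continuousOn h.continuousOn_fst).add
      (continuousOn_const.mul (Complex.continuous_ofReal.comp_continuousOn h.continuousOn_snd)))
    (fun t ht => h.hasDerivAt_fst_add_mul_snd ht) (fun t ht => ?_)
    (le_of_eq_of_le (by simp [h.init_fst, h.init_snd]) (le_add_of_nonneg_right
      (by positivity : 0 ≤ V / ((muMinus δ l).re - γ)))) ht
  rw [Complex.norm_real, Real.norm_eq_abs, ← mul_assoc]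
  refine (hf t ht).trans (mul_le_mul_of_nonneg_right ?_ (Real.exp_nonneg _))
  rw [mul_add, mul_div_cancel₀ _ hm'.ne']
  exact le_add_of_nonneg_left (by positivity)

theorem IsMode.abs_fst_le_of_lt_re (h : IsMode δ l f a y z)
    (hp : γ < (muPlus δ l).re) (hm : γ < (muMinus δ l).re)
    (hf : ∀ t, 0 < t → |f t| ≤ V * Real.exp (-γ * t)) (ht : 0 ≤ t) :
    |y t| ≤ (1 + ‖(δ : ℂ) - muPlus δ l‖ / ((muPlus δ l).re - γ))
      * ((|a| + V / ((muMinus δ l).re - γ)) * Real.exp (-γ * t)) := by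
  set p := muPlus δ l
  set D := |a| + V / ((muMinus δ l).re - γ)
  have hp' : 0 < p.re - γ := sub_pos.2 hp
  have hD : 0 ≤ D :=
    add_nonneg (abs_nonneg a) (div_nonneg (nonneg_of_forcing_le hf) (sub_pos.2 hm).le)
  have hz : ‖(z t : ℂ)‖ ≤ D / (p.re - γ) * Real.exp (-γ * t) := by
    refine norm_le_mul_exp (μ := p) (x := fun t => (z t : ℂ)) (g := fun t => y t + (p - δ) * z t)
      (Complex.continuous_ofReal.comp_continuousOn h.continuousOn_snd) (fun t ht => ?_)
      (fun t ht => ?_) (by simp only [h.init_snd, Complex.ofReal_zero, norm_zero]; positivity) ht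
    · exact (h.hasDerivAt_snd t ht).ofReal_comp.congr_deriv (by push_cast; ring)
    · rw [← mul_assoc, mul_div_cancel₀ _ hp'.ne']
      exact h.norm_fst_add_mul_snd_le hm hf ht.le
  calc |y t| = ‖(y t + (p - δ) * z t) + (δ - p) * z t‖ := by
        rw [← Real.norm_eq_abs, ← Complex.norm_real]; ring_nf
    _ ≤ D * Real.exp (-γ * t) + ‖(δ : ℂ) - p‖ * (D / (p.re - γ) * Real.exp (-γ * t)) := by
        refine (norm_add_le _ _).trans (add_le_add (h.norm_fst_add_mul_snd_le hm hf ht) ?_)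
        rw [norm_mul]
        exact mul_le_mul_of_nonneg_left hz (norm_nonneg _)
    _ = _ := by ring

end CharacteristicExponents

section UniformDecay

theorem exists_forall_of_eventually {P : ℕ → ℝ → Prop}
    (hmono : ∀ n C C', C ≤ C' → P n C → P n C') (hP : ∀ n, ∃ C, P n C)
    (hev : ∃ C, ∀ᶠ n in atTop, P n C) : ∃ C, 0 ≤ C ∧ ∀ n, P n C := by
  obtain ⟨C, hC⟩ := hev
  obtain ⟨J, hJ⟩ := eventually_atTop.1 hC
  choose c hc using hP
  have hsum : 0 ≤ ∑ n ∈ Finset.range J, |c n| := Finset.sum_nonneg fun n _ => abs_nonneg _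
  refine ⟨|C| + ∑ n ∈ Finset.range J, |c n|, by positivity, fun n => ?_⟩
  rcases lt_or_ge n J with hn | hn
  · refine hmono n _ _ ?_ (hc n)
    linarith [le_abs_self (c n), abs_nonneg C, Finset.single_le_sum (f := fun n => |c n|)
      (fun n _ => abs_nonneg _) (Finset.mem_range.2 hn)]
  · exact hmono n _ _ (by linarith [le_abs_self C]) (hJ n hn)

/-- The constant `C` controls, uniformly over data and forcing, the decay at rate `γ` of the modes
with eigenvalue `l` at the times satisfying `p`. -/
def IsDecayConst (δ γ l : ℝ) (p : ℝ → Prop) (C : ℝ) : Prop :=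
  ∀ (f : ℝ → ℝ) (a V : ℝ) (y z : ℝ → ℝ), IsMode δ l f a y z →
    (∀ t, 0 < t → |f t| ≤ V * Real.exp (-(γ + 1) * t)) →
    ∀ t, 0 ≤ t → p t → |y t| ≤ C * ((|a| + V) * Real.exp (-γ * t))

variable {δ γ l C : ℝ} {p : ℝ → Prop}

theorem IsDecayConst.mono {C' : ℝ} (hC : C ≤ C') (h : IsDecayConst δ γ l p C) :
    IsDecayConst δ γ l p C' := fun f a V y z hm hf t ht hpt => by
  have := nonneg_of_forcing_le hf
  exact (h f a V y z hm hf t ht hpt).trans (mul_le_mul_of_nonneg_right hC (by positivity))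

theorem isDecayConst_two (hδ : 0 ≤ δ) (hγ : γ ≤ δ + 1) (hl : γ + 2 ≤ l) :
    IsDecayConst δ γ l p 2 := fun _ _ _ _ _ hm hf _ ht _ => hm.abs_le_mul_exp_of_le hδ hγ hl hf ht

theorem exists_isDecayConst_of_lt_re (hp : γ < (muPlus δ l).re) (hm : γ < (muMinus δ l).re) :
    ∃ C, IsDecayConst δ γ l p C := by
  have : 0 < (muPlus δ l).re - γ := sub_pos.2 hp
  have : 0 < (muMinus δ l).re - γ := sub_pos.2 hm
  refine ⟨(1 + ‖(δ : ℂ) - muPlus δ l‖ / ((muPlus δ l).re - γ))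
    * (1 + 1 / ((muMinus δ l).re - γ)), fun f a V y z h hf t ht _ => ?_⟩
  have hV := nonneg_of_forcing_le hf
  refine (h.abs_fst_le_of_lt_re (V := V) hp hm (fun s hs => (hf s hs).trans ?_) ht).trans ?_
  · exact mul_le_mul_of_nonneg_left (Real.exp_le_exp.2 (by linarith)) hV
  · rw [mul_assoc, ← mul_assoc (1 + 1 / _)]
    gcongr _ * (?_ * _)
    have : 0 ≤ 1 / ((muMinus δ l).re - γ) * |a| := by positivity
    rw [add_mul, mul_add, one_mul, div_eq_mul_one_div V]
    linarith

theorem exists_isDecayConst_of_le (hδ : 0 ≤ δ) (hγ : γ ≤ δ + 1) {T : ℝ} (hp : ∀ t, p t → t ≤ T) :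
    ∃ C, IsDecayConst δ γ l p C := by
  set γ' := min γ (l - 2)
  have hγ' : γ' ≤ γ := min_le_left _ _
  refine ⟨2 * Real.exp ((γ - γ') * T), fun f a V y z h hf t ht hpt => ?_⟩
  have hV := nonneg_of_forcing_le hf
  refine (h.abs_le_mul_exp_of_le (V := V) hδ (hγ'.trans hγ) (by linarith [min_le_right γ (l - 2)])
    (fun s hs => (hf s hs).trans ?_) ht).trans ?_
  · exact mul_le_mul_of_nonneg_left (Real.exp_le_exp.2 (by nlinarith)) hV
  · have hexp : Real.exp (-γ' * t) ≤ Real.exp ((γ - γ') * T) * Real.exp (-γ * t) := by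
      rw [← Real.exp_add]
      exact Real.exp_le_exp.2 (by nlinarith [hp t hpt])
    have := mul_le_mul_of_nonneg_left hexp (by positivity : 0 ≤ 2 * (|a| + V))
    linarith

theorem exists_uniform_isDecayConst (hδ : 0 ≤ δ) (hγ : γ < δ + 1) {lam : ℕ → ℝ}
    (hlam : Tendsto lam atTop atTop) {N : ℕ} (hN : unstableDim δ γ lam ≤ N) (T : ℝ) :
    ∃ C, 0 ≤ C ∧ ∀ n, IsDecayConst δ γ (lam n) (fun t => n < N → t ≤ T) C := by
  refine exists_forall_of_eventually (fun n C C' hC h => h.mono hC) (fun n => ?_)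
    ⟨2, (hlam.eventually_ge_atTop (γ + 2)).mono fun n hn => isDecayConst_two hδ hγ.le hn⟩
  rcases lt_or_ge n N with hn | hn
  · exact exists_isDecayConst_of_le hδ hγ.le fun t ht => ht hn
  · obtain ⟨hplus, hminus⟩ := lt_re_of_unstableDim_le (by linarith) hγ hlam (hN.trans hn)
    exact exists_isDecayConst_of_lt_re hplus hminus

end UniformDecay

section Coordinates

variable {H : Type*} [NormedAddCommGroup H] [InnerProductSpace ℝ H] {ι : Type*}
  {φ : HilbertBasis ι ℝ H}

theorem ext_inner_basis {x y : H} (h : ∀ n, ⟪φ n, x⟫_ℝ = ⟪φ n, y⟫_ℝ) : x = y := by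
  apply φ.repr.injective
  ext n
  rw [φ.repr_apply_apply, φ.repr_apply_apply, h]

variable (φ) in
theorem memℓp_inner (x : H) : Memℓp (fun n => ⟪φ n, x⟫_ℝ) 2 :=
  (funext (φ.repr_apply_apply x) : (φ.repr x : ι → ℝ) = _) ▸ lp.memℓp (φ.repr x)

variable (φ) in
theorem exists_inner_basis_eq {c : ι → ℝ} (hc : Memℓp c 2) : ∃ x : H, ∀ n, ⟪φ n, x⟫_ℝ = c n :=
  ⟨φ.repr.symm ⟨c, hc⟩, fun n => by
    rw [← φ.repr_apply_apply, LinearIsometryEquiv.apply_symm_apply]⟩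

theorem summable_sq_of_memℓp {c : ι → ℝ} (hc : Memℓp c 2) : Summable fun n => c n ^ 2 := by
  simpa using hc.summable (by norm_num)

variable (φ) in
theorem hasSum_inner_sq [CompleteSpace H] (x : H) :
    HasSum (fun n => ⟪φ n, x⟫_ℝ ^ 2) (‖x‖ ^ 2) := by
  simpa only [real_inner_self_eq_norm_sq, real_inner_comm, ← pow_two]
    using φ.hasSum_inner_mul_inner x x

theorem norm_le_norm_of_abs_inner_le [CompleteSpace H] {x y : H}
    (h : ∀ n, |⟪φ n, x⟫_ℝ| ≤ |⟪φ n, y⟫_ℝ|) : ‖x‖ ≤ ‖y‖ := by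
  refine le_of_sq_le_sq ?_ (norm_nonneg y)
  exact hasSum_le (fun n => sq_le_sq.2 (h n)) (hasSum_inner_sq φ x) (hasSum_inner_sq φ y)

/-- The vector whose coordinates in the basis `φ` are the absolute values of those of `x`. It is
used to express domination of coordinates by vectors of controlled norm. -/
def modulus (φ : HilbertBasis ι ℝ H) (x : H) : H :=
  φ.repr.symm ⟨fun n => ‖⟪φ n, x⟫_ℝ‖, memℓp_norm_iff.2 (memℓp_inner φ x)⟩

theorem inner_modulus (x : H) (n : ι) : ⟪φ n, modulus φ x⟫_ℝ = |⟪φ n, x⟫_ℝ| := by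
  rw [← φ.repr_apply_apply, modulus, LinearIsometryEquiv.apply_symm_apply, ← Real.norm_eq_abs]

theorem norm_modulus_le [CompleteSpace H] (x : H) : ‖modulus φ x‖ ≤ ‖x‖ :=
  norm_le_norm_of_abs_inner_le (φ := φ) fun n => by rw [inner_modulus, abs_abs]

theorem mem_graph_fracPow {φ : HilbertBasis ℕ ℝ H} {lam : ℕ → ℝ} {s : ℝ} {x g : H}
    (h : ∀ n, ⟪φ n, g⟫_ℝ = lam n ^ s * ⟪φ n, x⟫_ℝ) : (x, g) ∈ (fracPow φ lam s).graph := by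
  have hx : x ∈ (fracPow φ lam s).domain := by
    change Memℓp (fun n => lam n ^ s * ⟪φ n, x⟫_ℝ) 2
    simpa only [h] using memℓp_inner φ g
  refine (LinearPMap.mem_graph_iff _).2 ⟨⟨x, hx⟩, rfl, ext_inner_basis (φ := φ) fun n => ?_⟩
  rw [h, ← φ.repr_apply_apply]
  exact congrFun (congrArg Subtype.val (φ.repr.apply_symm_apply _)) n

end Coordinates

section Curves

variable {H : Type*} [NormedAddCommGroup H] [InnerProductSpace ℝ H] {ι : Type*}
  {φ : HilbertBasis ι ℝ H} {c d : ι → ℝ → ℝ} {S : Set ℝ} {Y Z : ℝ → H}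

/-- Locally in `S`, the functions `c n` are dominated, up to finitely many indices `n`, by a
square summable sequence. For the coordinates of a curve this is what dominated convergence needs
to produce a continuous curve. -/
def IsLocallyDominated (c : ι → ℝ → ℝ) (S : Set ℝ) : Prop :=
  ∀ t ∈ S, ∃ U ∈ 𝓝[S] t, ∃ G : ι → ℝ, Memℓp G 2 ∧ ∀ᶠ n in cofinite, ∀ s ∈ U, |c n s| ≤ G n

theorem IsLocallyDominated.of_le {G : ι → ℝ} (hG : Memℓp G 2)
    (h : ∀ᶠ n in cofinite, ∀ s ∈ S, |c n s| ≤ G n) : IsLocallyDominated c S :=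
  fun _ _ => ⟨S, self_mem_nhdsWithin, G, hG, h⟩

theorem IsLocallyDominated.exists_forall_le (h : IsLocallyDominated c S)
    (hc : ∀ n, ContinuousOn (c n) S) {t : ℝ} (ht : t ∈ S) :
    ∃ U ∈ 𝓝[S] t, ∃ G : ι → ℝ, Memℓp G 2 ∧ ∀ n, ∀ s ∈ U, |c n s| ≤ G n := by
  obtain ⟨U, hU, G, hG, hle⟩ := h t ht
  set F : Set ι := {n | ¬ ∀ s ∈ U, |c n s| ≤ G n}
  have hfin : F.Finite := hle
  have hnear : ∀ᶠ s in 𝓝[S] t, ∀ n ∈ F, |c n s| ≤ |c n t| + 1 :=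
    (eventually_all_finite hfin).2 fun n _ =>
      (hc n t ht).tendsto.abs.eventually (eventually_le_nhds (lt_add_one _))
  have hsupp : Memℓp (F.indicator fun n => |c n t| + 1) 2 :=
    (memℓp_zero (hfin.subset support_indicator_subset)).of_exponent_ge zero_le
  refine ⟨_, inter_mem hU hnear, _, (memℓp_norm_iff.2 hG).add hsupp, fun n s hs => ?_⟩
  by_cases hn : n ∈ F
  · simpa [hn] using (hs.2 n hn).trans (le_add_of_nonneg_left (abs_nonneg (G n)))
  · simpa [hn] using (not_not.1 hn s hs.1).trans (le_abs_self (G n))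

/-- On `S`, the curve `Y` is continuous and has the functions `c n` as coordinates. -/
structure HasCoordsOn (φ : HilbertBasis ι ℝ H) (c : ι → ℝ → ℝ) (S : Set ℝ) (Y : ℝ → H) :
    Prop where
  inner_eq : ∀ n, ∀ t ∈ S, ⟪φ n, Y t⟫_ℝ = c n t
  continuousOn : ContinuousOn Y S

theorem HasCoordsOn.of_isLocallyDominated [CompleteSpace H] (h : IsLocallyDominated c S)
    (hc : ∀ n, ContinuousOn (c n) S) (hY : ∀ n, ∀ t ∈ S, ⟪φ n, Y t⟫_ℝ = c n t) :
    HasCoordsOn φ c S Y := by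
  refine ⟨hY, fun t ht => ?_⟩
  obtain ⟨U, hU, G, hG, hle⟩ := h.exists_forall_le hc ht
  have hcoord : ∀ n, Tendsto (fun s => (c n s - c n t) ^ 2) (𝓝[S] t) (𝓝 0) := fun n => by
    simpa using ((hc n t ht).tendsto.sub_const (c n t)).pow 2
  have hsum : Summable fun n => (2 * G n) ^ 2 := summable_sq_of_memℓp (hG.const_mul 2)
  have hlim := tendsto_tsum_of_dominated_convergence hsum hcoord (by
    filter_upwards [hU] with s hs n
    have hdiff : |c n s - c n t| ≤ 2 * G n := by
      linarith [abs_sub (c n s) (c n t), hle n s hs, hle n t (mem_of_mem_nhdsWithin ht hU)]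
    rw [Real.norm_eq_abs, abs_pow]
    exact pow_le_pow_left₀ (abs_nonneg _) hdiff 2)
  have hnorm : ∀ s ∈ S, ∑' n, (c n s - c n t) ^ 2 = ‖Y s - Y t‖ ^ 2 := fun s hs => by
    simpa only [inner_sub_right, hY _ s hs, hY _ t ht] using (hasSum_inner_sq φ (Y s - Y t)).tsum_eq
  rw [tsum_zero, tendsto_congr' (eventually_nhdsWithin_of_forall hnorm)] at hlim
  rw [ContinuousWithinAt, tendsto_iff_norm_sub_tendsto_zero]
  simpa [Function.comp_def, Real.sqrt_sq] using (Real.continuous_sqrt.tendsto 0).comp hlim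

variable (φ) in
theorem exists_hasCoordsOn [CompleteSpace H] (h : IsLocallyDominated c S)
    (hc : ∀ n, ContinuousOn (c n) S) : ∃ Y : ℝ → H, HasCoordsOn φ c S Y := by
  have hex : ∀ t, ∃ x : H, t ∈ S → ∀ n, ⟪φ n, x⟫_ℝ = c n t := fun t => by
    by_cases ht : t ∈ S
    · obtain ⟨U, hU, G, hG, hle⟩ := h.exists_forall_le hc ht
      obtain ⟨x, hx⟩ := exists_inner_basis_eq φ
        (hG.mono fun n => hle n t (mem_of_mem_nhdsWithin ht hU))
      exact ⟨x, fun _ => hx⟩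
    · exact ⟨0, fun h => absurd h ht⟩
  choose Y hY using hex
  exact ⟨Y, .of_isLocallyDominated h hc fun n t ht => hY t ht n⟩

theorem HasCoordsOn.continuousOn_coord (hY : HasCoordsOn φ c S Y) (n : ι) :
    ContinuousOn (c n) S :=
  (continuousOn_const.inner hY.continuousOn).congr fun t ht => (hY.inner_eq n t ht).symm

theorem HasCoordsOn.hasDerivWithinAt [CompleteSpace H] (hY : HasCoordsOn φ c S Y)
    (hZ : HasCoordsOn φ d S Z) {a : ℝ} (ha : Ici a ⊆ S)
    (hd : ∀ n t, a < t → HasDerivAt (c n) (d n t) t) {t : ℝ} (ht : a ≤ t) :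
    HasDerivWithinAt Y (Z t) (Ici a) t := by
  have hcont : Continuous fun t => Z (max t a) :=
    (hZ.continuousOn.mono ha).comp_continuous (by fun_prop) fun t => mem_Ici.2 (le_max_right _ _)
  have hprim := (hcont.integral_hasStrictDerivAt a t).hasDerivAt.const_add (Y a)
  rw [max_eq_left ht] at hprim
  refine hprim.hasDerivWithinAt.congr_of_mem (fun s hs => ext_inner_basis (φ := φ) fun n => ?_) ht
  have hcomm := (innerSL ℝ (φ n)).intervalIntegral_comp_comm
    (hcont.intervalIntegrable (μ := volume) a s)
  simp only [innerSL_apply_apply] at hcomm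
  have hcn : ContinuousOn (c n) (Icc a s) := (hY.continuousOn_coord n).mono fun r hr => ha hr.1
  have hftc := intervalIntegral.integral_eq_sub_of_hasDerivAt_of_le hs hcn
    (f' := fun t => ⟪φ n, Z (max t a)⟫_ℝ)
    (fun t ht => by
      rw [max_eq_left ht.1.le, hZ.inner_eq n t (ha ht.1.le)]
      exact hd n t ht.1)
    ((continuous_const.inner hcont).intervalIntegrable _ _)
  rw [inner_add_right, ← hcomm, hftc, hY.inner_eq n s (ha hs),
    hY.inner_eq n a (ha self_mem_Ici)]
  ring

theorem memLp_two_of_continuousOn {E : Type*} [NormedAddCommGroup E] {f : ℝ → E} {a b : ℝ}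
    (hf : ContinuousOn f (Icc a b)) : MemLp f 2 (volume.restrict (Ioo a b)) := by
  obtain ⟨C, hC⟩ := isCompact_Icc.exists_bound_of_continuousOn hf
  refine MemLp.of_bound ((hf.mono Ioo_subset_Icc_self).aestronglyMeasurable measurableSet_Ioo) C ?_
  exact (ae_restrict_mem measurableSet_Ioo).mono fun t ht => hC t (Ioo_subset_Icc_self ht)

end Curves

section Operator

variable {H : Type*} [NormedAddCommGroup H] [InnerProductSpace ℝ H] {A : H →ₗ.[ℝ] H}

theorem inner_apply_eq_inner_apply [CompleteSpace H] (hA : IsSelfAdjoint A) (x w : A.domain) :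
    ⟪A x, (w : H)⟫_ℝ = ⟪(x : H), A w⟫_ℝ := by
  have h := LinearPMap.adjoint_isFormalAdjoint hA.dense_domain
  rw [LinearPMap.isSelfAdjoint_def.1 hA] at h
  exact h x w

theorem inner_eq_of_mem_graph [CompleteSpace H] (hA : IsSelfAdjoint A) {x g : H}
    (hx : (x, g) ∈ A.graph) (w : A.domain) : ⟪g, (w : H)⟫_ℝ = ⟪x, A w⟫_ℝ := by
  obtain ⟨x', rfl, rfl⟩ := A.mem_graph_iff.1 hx
  exact inner_apply_eq_inner_apply hA x' w

theorem not_isCompactOperator_of_orthonormal {T : H →L[ℝ] H} {e : ℕ → H} {c : ℕ → ℝ} {ε : ℝ}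
    (he : Orthonormal ℝ e) (hε : 0 < ε) (hc : ∀ n, ε ≤ |c n|) (hT : ∀ n, T (e n) = c n • e n) :
    ¬ IsCompactOperator T := fun hcomp => by
  obtain ⟨K, hK, hsub⟩ := hcomp.image_closedBall_subset_compact 1
  have hmem : ∀ n, T (e n) ∈ K := fun n => hsub (mem_image_of_mem _ (by simp [he.1 n]))
  obtain ⟨x, -, u, hu, hx⟩ := hK.tendsto_subseq hmem
  have hsep : ∀ m n, m ≠ n → ε ≤ ‖T (e m) - T (e n)‖ := fun m n hmn => by
    have hinner : ⟪e m, T (e m) - T (e n)⟫_ℝ = c m := by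
      simp [hT, inner_sub_right, inner_smul_right, he.2 hmn, he.1 m]
    calc ε ≤ |⟪e m, T (e m) - T (e n)⟫_ℝ| := hinner ▸ hc m
      _ ≤ ‖e m‖ * ‖T (e m) - T (e n)‖ := abs_real_inner_le_norm _ _
      _ = ‖T (e m) - T (e n)‖ := by rw [he.1 m, one_mul]
  obtain ⟨n, hn⟩ := Metric.cauchySeq_iff.1 hx.cauchySeq ε hε
  refine (hn n le_rfl (n + 1) (Nat.le_succ n)).not_ge ?_
  rw [dist_eq_norm]
  exact hsep _ _ (hu.injective.ne (Nat.lt_succ_self n).ne)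

namespace IsEigenbasis

variable {φ : HilbertBasis ℕ ℝ H} {lam : ℕ → ℝ}

theorem inner_apply [CompleteSpace H] (hφ : IsEigenbasis A φ lam) (hA : IsSelfAdjoint A)
    (w : A.domain) (n : ℕ) : ⟪φ n, A w⟫_ℝ = lam n * ⟪φ n, (w : H)⟫_ℝ := by
  obtain ⟨hn, heig⟩ := hφ.eigen n
  rw [← inner_apply_eq_inner_apply hA ⟨φ n, hn⟩ w, heig, real_inner_smul_left]

theorem mem_graph (hφ : IsEigenbasis A φ lam) (hA : A.IsClosed) {x g : H}
    (h : ∀ n, ⟪φ n, g⟫_ℝ = lam n * ⟪φ n, x⟫_ℝ) : (x, g) ∈ A.graph := by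
  refine IsClosed.mem_of_tendsto (s := (A.graph : Set (H × H))) hA
    ((φ.hasSum_repr x).prodMk (φ.hasSum_repr g))
    (.of_forall fun s => Submodule.sum_mem _ fun n _ => ?_)
  obtain ⟨hn, heig⟩ := hφ.eigen n
  have hsmul := A.graph.smul_mem ⟪φ n, x⟫_ℝ (heig ▸ A.mem_graph ⟨φ n, hn⟩)
  rwa [Prod.smul_mk, smul_smul, mul_comm, ← h, ← φ.repr_apply_apply, ← φ.repr_apply_apply]
    at hsmul

theorem tendsto_atTop (hφ : IsEigenbasis A φ lam) (hA : HasCompactResolvent A) :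
    Tendsto lam atTop atTop := by
  refine (tendsto_atTop_of_monotone hφ.mono).resolve_right fun ⟨L, hL⟩ => ?_
  obtain ⟨r, T, hT, hleft, -⟩ := hA
  have hTφ : ∀ n, (r - lam n) • T (φ n) = φ n := fun n => by
    obtain ⟨hn, heig⟩ := hφ.eigen n
    simpa only [heig, ← sub_smul, map_smul] using hleft ⟨φ n, hn⟩
  have hne : ∀ n, r - lam n ≠ 0 := fun n h0 =>
    φ.orthonormal.ne_zero n (by rw [← hTφ n, h0, zero_smul])
  have hbdd : ∀ n, |r - lam n| ≤ |r| + max |lam 0| |L| := fun n =>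
    (abs_sub _ _).trans (add_le_add_right
      (abs_le_max_abs_abs (hφ.mono n.zero_le) (hφ.mono.ge_of_tendsto hL n)) _)
  have hpos : 0 < |r| + max |lam 0| |L| := (abs_pos.2 (hne 0)).trans_le (hbdd 0)
  exact not_isCompactOperator_of_orthonormal φ.orthonormal (inv_pos.2 hpos)
    (fun n => abs_inv (r - lam n) ▸ inv_anti₀ (abs_pos.2 (hne n)) (hbdd n))
    (fun n => (eq_inv_smul_iff₀ (hne n)).2 (hTφ n)) hT

end IsEigenbasis

end Operator

section Memory

variable {E : Type*} [NormedAddCommGroup E] [NormedSpace ℝ E] {β : ℝ → ℝ} {δ t : ℝ}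

/-- The memory term `∫₀ᵗ β (t - s) Y(s) ds` of a curve `Y`. -/
def memory (β : ℝ → ℝ) (Y : ℝ → E) (t : ℝ) : E :=
  ∫ s in (0 : ℝ)..t, β (t - s) • Y s

theorem eqOn_exp_of_hasDerivAt (hβ0 : β 0 = 1) (hβc : ContinuousOn β (Ici 0))
    (hβ : ∀ t, 0 < t → HasDerivAt β (-(δ * β t)) t) :
    EqOn β (fun t => Real.exp (-δ * t)) (Ici 0) := fun t (ht : 0 ≤ t) => by
  have hftc := intervalIntegral.integral_eq_sub_of_hasDerivAt_of_le
    (f := fun s => Real.exp (δ * s) * β s) (f' := fun _ => 0) ht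
    (by have := hβc.mono (Icc_subset_Ici_self : Icc 0 t ⊆ Ici 0); fun_prop)
    (fun s hs => ((((hasDerivAt_id s).const_mul δ).exp).mul (hβ s hs.1)).congr_deriv
      (by simp only [id]; ring))
    (by simp)
  simp only [intervalIntegral.integral_zero, mul_zero, Real.exp_zero, hβ0, mul_one] at hftc
  have hinv : Real.exp (-δ * t) * Real.exp (δ * t) = 1 := by rw [← Real.exp_add]; simp
  linear_combination (-Real.exp (-δ * t)) * hftc - β t * hinv

theorem continuousOn_of_eqOn_exp (hβ : EqOn β (fun t => Real.exp (-δ * t)) (Ici 0)) :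
    ContinuousOn β (Ici 0) :=
  (by fun_prop : Continuous fun t => Real.exp (-δ * t)).continuousOn.congr hβ

theorem memory_congr {Y Y' : ℝ → E} (h : EqOn Y Y' (Ici 0)) (ht : 0 ≤ t) :
    memory β Y t = memory β Y' t :=
  intervalIntegral.integral_congr fun s hs => by
    rw [uIcc_of_le ht] at hs
    simp only [h hs.1]

theorem inner_memory {H : Type*} [NormedAddCommGroup H] [InnerProductSpace ℝ H] [CompleteSpace H]
    {Y : ℝ → H} (hβ : ContinuousOn β (Ici 0)) (hY : ContinuousOn Y (Ici 0)) (ht : 0 ≤ t) (w : H) :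
    ⟪w, memory β Y t⟫_ℝ = memory β (fun s => ⟪w, Y s⟫_ℝ) t := by
  have hint : IntervalIntegrable (fun s => β (t - s) • Y s) volume 0 t :=
    ((hβ.comp (continuousOn_const.sub continuousOn_id) fun s hs => sub_nonneg.2 hs.2).smul
      (hY.mono Icc_subset_Ici_self)).intervalIntegrable_of_Icc ht
  have hcomm := (innerSL ℝ w).intervalIntegral_comp_comm hint
  simp only [innerSL_apply_apply, inner_smul_right] at hcomm
  exact hcomm.symm

theorem memory_eq_of_hasDerivAt {y z : ℝ → ℝ} (hβ : EqOn β (fun t => Real.exp (-δ * t)) (Ici 0))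
    (hy : ContinuousOn y (Ici 0)) (hz : ContinuousOn z (Ici 0)) (hz0 : z 0 = 0)
    (hd : ∀ t, 0 < t → HasDerivAt z (y t - δ * z t) t) (ht : 0 ≤ t) : memory β y t = z t := by
  have hyt := hy.mono (Icc_subset_Ici_self : Icc 0 t ⊆ Ici 0)
  have hzt := hz.mono (Icc_subset_Ici_self : Icc 0 t ⊆ Ici 0)
  have hftc := intervalIntegral.integral_eq_sub_of_hasDerivAt_of_le
    (f := fun s => Real.exp (-δ * (t - s)) * z s) (f' := fun s => Real.exp (-δ * (t - s)) * y s) ht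
    (by fun_prop)
    (fun s hs => ((((hasDerivAt_id s).const_sub t).const_mul (-δ)).exp.mul
      (hd s hs.1)).congr_deriv (by simp only [id]; ring))
    (ContinuousOn.intervalIntegrable_of_Icc ht (by fun_prop))
  calc memory β y t = ∫ s in (0 : ℝ)..t, Real.exp (-δ * (t - s)) * y s :=
        intervalIntegral.integral_congr fun s hs => by
          rw [uIcc_of_le ht] at hs
          simp only [hβ (sub_nonneg.2 hs.2 : t - s ∈ Ici 0), smul_eq_mul]
    _ = z t := by simpa only [sub_self, mul_zero, Real.exp_zero, one_mul, hz0, sub_zero] using hftc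

theorem continuousOn_hasDerivAt_memory {y : ℝ → ℝ}
    (hβ : EqOn β (fun t => Real.exp (-δ * t)) (Ici 0)) (hy : ContinuousOn y (Ici 0)) :
    ContinuousOn (memory β y) (Ici 0) ∧
      ∀ t, 0 < t → HasDerivAt (memory β y) (y t - δ * memory β y t) t := by
  have hcont : Continuous fun t => (y (max t 0) : ℂ) :=
    Complex.continuous_ofReal.comp
      (hy.comp_continuous (by fun_prop) fun t => mem_Ici.2 (le_max_right _ _))
  obtain ⟨x, hx0, hx⟩ := exists_hasDerivAt_firstOrder δ 0 hcont
  have hre : ∀ t, HasDerivAt (fun t => (x t).re) (y (max t 0) - δ * (x t).re) t := fun t =>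
    (Complex.reCLM.hasFDerivAt.comp_hasDerivAt t (hx t)).congr_deriv (by simp)
  have hrec : ContinuousOn (fun t => (x t).re) (Ici 0) := fun t _ =>
    (hre t).continuousAt.continuousWithinAt
  have heq : EqOn (memory β y) (fun t => (x t).re) (Ici 0) := fun t ht =>
    memory_eq_of_hasDerivAt hβ hy hrec (by simp [hx0])
      (fun s hs => (hre s).congr_deriv (by rw [max_eq_left hs.le])) ht
  refine ⟨hrec.congr heq, fun t ht => ?_⟩
  rw [heq ht.le]
  refine ((hre t).congr_of_eventuallyEq ?_).congr_deriv (by rw [max_eq_left ht.le])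
  filter_upwards [eventually_gt_nhds ht] with s hs using heq hs.le

end Memory

section ModeFamily

variable {H : Type*} [NormedAddCommGroup H] [InnerProductSpace ℝ H] {ι : Type*}
  {φ : HilbertBasis ι ℝ H} {lam : ι → ℝ} {δ : ℝ} {f : ℝ → H} {y₀ : H} {V : ι → ℝ}
  {y z c d : ι → ℝ → ℝ} {S : Set ℝ} {Y : ℝ → H}

/-- The modes `y n` of the equation with eigenvalues `lam n → ∞`, initial value `y₀` and a forcing
`f` whose coordinates are dominated by the square summable sequence `V`; `z n` is the memory
of `y n`. -/
structure IsModeFamily (φ : HilbertBasis ι ℝ H) (lam : ι → ℝ) (δ : ℝ) (f : ℝ → H) (y₀ : H)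
    (V : ι → ℝ) (y z : ι → ℝ → ℝ) : Prop where
  tendsto_lam : Tendsto lam cofinite atTop
  isMode : ∀ n, IsMode δ (lam n) (fun t => ⟪φ n, f t⟫_ℝ) ⟪φ n, y₀⟫_ℝ (y n) (z n)
  abs_inner_le : ∀ n t, 0 < t → |⟪φ n, f t⟫_ℝ| ≤ V n
  memℓp : Memℓp V 2

theorem IsLocallyDominated.mono (h : IsLocallyDominated d S)
    (hcd : ∀ᶠ n in cofinite, ∀ t ∈ S, |c n t| ≤ |d n t|) : IsLocallyDominated c S := fun t ht => by
  obtain ⟨U, hU, G, hG, hle⟩ := h t ht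
  refine ⟨U ∩ S, inter_mem hU self_mem_nhdsWithin, G, hG, ?_⟩
  filter_upwards [hle, hcd] with n hn hcdn s hs using (hcdn s hs.2).trans (hn s hs.1)

theorem mul_exp_neg_le_div {l t ε : ℝ} (hl : 2 ≤ l) (hε : 0 < ε) (ht : ε ≤ t) :
    l * Real.exp (-(l - 1) * t) ≤ 2 / ε := by
  have hexp : (l - 1) * t ≤ Real.exp ((l - 1) * t) :=
    (le_add_of_nonneg_right zero_le_one).trans (Real.add_one_le_exp _)
  rw [neg_mul, Real.exp_neg, ← div_eq_mul_inv, div_le_div_iff₀ (Real.exp_pos _) hε]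
  nlinarith [mul_le_mul_of_nonneg_left ht (by linarith : 0 ≤ l - 1)]

theorem rpow_half_abs_mul_le {l x : ℝ} (hl : 1 ≤ l) : |l ^ (1 / 2 : ℝ) * x| ≤ |l * x| := by
  have hpos : 0 < l := one_pos.trans_le hl
  rw [abs_mul, abs_mul, abs_of_pos hpos, abs_of_pos (Real.rpow_pos_of_pos hpos _)]
  refine mul_le_mul_of_nonneg_right ?_ (abs_nonneg x)
  simpa using Real.rpow_le_rpow_of_exponent_le hl (by norm_num : (1 / 2 : ℝ) ≤ 1)

namespace IsModeFamily

variable (h : IsModeFamily φ lam δ f y₀ V y z)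

include h

theorem eventually_three_le : ∀ᶠ n in cofinite, 3 ≤ lam n :=
  h.tendsto_lam.eventually_ge_atTop 3

theorem memℓp_bound : Memℓp (fun n => |⟪φ n, y₀⟫_ℝ| + V n) 2 :=
  (memℓp_norm_iff.2 (memℓp_inner φ y₀)).add h.memℓp

theorem isLocallyDominated_fst (hδ : 0 ≤ δ) : IsLocallyDominated y (Ici 0) := by
  refine .of_le (h.memℓp_bound.const_mul 2) ?_
  filter_upwards [h.eventually_three_le] with n hn t ht
  obtain ⟨hw, hz⟩ := (h.isMode n).abs_le_of_forcing_bounded hδ hn (h.abs_inner_le n) ht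
  calc |y n t| = |(y n t + z n t) - z n t| := by rw [add_sub_cancel_right]
    _ ≤ |y n t + z n t| + |z n t| := abs_sub _ _
    _ ≤ 2 * (|⟪φ n, y₀⟫_ℝ| + V n) := by linarith

theorem isLocallyDominated_mul_snd (hδ : 0 ≤ δ) :
    IsLocallyDominated (fun n t => lam n * z n t) (Ici 0) := by
  refine .of_le (h.memℓp_bound.const_mul (2 * (3 + δ))) ?_
  filter_upwards [h.eventually_three_le] with n hn t ht
  rw [abs_mul, abs_of_nonneg (by linarith)]
  exact (h.isMode n).mul_abs_snd_le hδ hn (h.abs_inner_le n) ht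

theorem isLocallyDominated_mul_fst (hδ : 0 ≤ δ) :
    IsLocallyDominated (fun n t => lam n * y n t) (Ioi 0) := fun t (ht : 0 < t) => by
  refine ⟨Ici (t / 2), mem_nhdsWithin_of_mem_nhds (Ici_mem_nhds (half_lt_self ht)), _,
    h.memℓp_bound.const_mul (2 / (t / 2) + (10 + 4 * δ)), ?_⟩
  filter_upwards [h.eventually_three_le] with n hn s hs
  have hV : 0 ≤ V n := (abs_nonneg _).trans (h.abs_inner_le n 1 one_pos)
  rw [abs_mul, abs_of_nonneg (by linarith), add_mul]
  refine ((h.isMode n).mul_abs_fst_le hδ hn (h.abs_inner_le n)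
    ((half_pos ht).le.trans hs)).trans (add_le_add_left ?_ _)
  exact mul_le_mul (mul_exp_neg_le_div (by linarith) (half_pos ht) hs)
    (le_add_of_nonneg_right hV) (abs_nonneg _) (by positivity)

theorem isLocallyDominated_mul_fst_Ici (hδ : 0 ≤ δ)
    (hy₀ : Memℓp (fun n => lam n * ⟪φ n, y₀⟫_ℝ) 2) :
    IsLocallyDominated (fun n t => lam n * y n t) (Ici 0) := by
  refine .of_le ((memℓp_norm_iff.2 hy₀).add (h.memℓp_bound.const_mul (10 + 4 * δ))) ?_
  filter_upwards [h.eventually_three_le] with n hn t (ht : 0 ≤ t)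
  have hl : 0 ≤ lam n := by linarith
  have hexp : Real.exp (-(lam n - 1) * t) ≤ 1 :=
    Real.exp_le_one_iff.2 (mul_nonpos_of_nonpos_of_nonneg (by linarith) ht)
  rw [abs_mul, abs_of_nonneg hl]
  refine ((h.isMode n).mul_abs_fst_le hδ hn (h.abs_inner_le n) ht).trans (add_le_add_left ?_ _)
  change _ ≤ |lam n * ⟪φ n, y₀⟫_ℝ|
  rw [abs_mul, abs_of_nonneg hl]
  exact mul_le_mul_of_nonneg_right (mul_le_of_le_one_right hl hexp) (abs_nonneg _)

theorem apply_zero_eq (hY : HasCoordsOn φ y (Ici 0) Y) : Y 0 = y₀ :=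
  ext_inner_basis (φ := φ) fun n => by rw [hY.inner_eq n 0 self_mem_Ici, (h.isMode n).init_fst]

theorem summable_integral_mul_sq (hδ : 0 ≤ δ) {T : ℝ}
    (hT : 0 ≤ T) : Summable fun n => ∫ t in Ioo 0 T, (lam n ^ (1 / 2 : ℝ) * y n t) ^ 2 := by
  refine Summable.of_norm_bounded_eventually
    ((summable_sq_of_memℓp h.memℓp_bound).mul_left (2 + (14 + 4 * δ) * T)) ?_
  filter_upwards [h.eventually_three_le] with n hn
  have hsq : (lam n ^ (1 / 2 : ℝ)) ^ 2 = lam n := by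
    rw [← Real.sqrt_eq_rpow, Real.sq_sqrt (by linarith)]
  rw [Real.norm_of_nonneg (integral_nonneg fun t => sq_nonneg _)]
  simp_rw [mul_pow, hsq]
  rw [← integral_Ioc_eq_integral_Ioo, ← intervalIntegral.integral_of_le hT]
  exact (h.isMode n).integral_mul_sq_le hδ hn (h.abs_inner_le n) hT

variable [CompleteSpace H]

theorem exists_hasCoordsOn_fst (hδ : 0 ≤ δ) : ∃ Y : ℝ → H, HasCoordsOn φ y (Ici 0) Y :=
  exists_hasCoordsOn φ (h.isLocallyDominated_fst hδ) fun n => (h.isMode n).continuousOn_fst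

theorem exists_hasCoordsOn_mul_snd (hδ : 0 ≤ δ) :
    ∃ L : ℝ → H, HasCoordsOn φ (fun n t => lam n * z n t) (Ici 0) L :=
  exists_hasCoordsOn φ (h.isLocallyDominated_mul_snd hδ)
    fun n => continuousOn_const.mul (h.isMode n).continuousOn_snd

theorem exists_hasCoordsOn_mul_fst (hδ : 0 ≤ δ) :
    ∃ W : ℝ → H, HasCoordsOn φ (fun n t => lam n * y n t) (Ioi 0) W :=
  exists_hasCoordsOn φ (h.isLocallyDominated_mul_fst hδ)
    fun n => continuousOn_const.mul ((h.isMode n).continuousOn_fst.mono Ioi_subset_Ici_self)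

theorem exists_hasCoordsOn_mul_fst_Ici (hδ : 0 ≤ δ)
    (hy₀ : Memℓp (fun n => lam n * ⟪φ n, y₀⟫_ℝ) 2) :
    ∃ W : ℝ → H, HasCoordsOn φ (fun n t => lam n * y n t) (Ici 0) W :=
  exists_hasCoordsOn φ (h.isLocallyDominated_mul_fst_Ici hδ hy₀)
    fun n => continuousOn_const.mul (h.isMode n).continuousOn_fst

theorem hasDerivWithinAt {W L : ℝ → H} {a t : ℝ} (hS : S ⊆ Ici 0)
    (hY : HasCoordsOn φ y (Ici 0) Y) (hW : HasCoordsOn φ (fun n t => lam n * y n t) S W)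
    (hL : HasCoordsOn φ (fun n t => lam n * z n t) (Ici 0) L) (hf : Continuous f)
    (ha : Ici a ⊆ S) (ht : a ≤ t) :
    HasDerivWithinAt Y (f t - W t - L t) (Ici a) t := by
  have hYS : HasCoordsOn φ y S Y :=
    ⟨fun n s hs => hY.inner_eq n s (hS hs), hY.continuousOn.mono hS⟩
  refine hYS.hasDerivWithinAt (Z := fun s => f s - W s - L s)
    (d := fun n s => ⟪φ n, f s⟫_ℝ - lam n * (y n s + z n s)) ⟨fun n s hs => ?_, ?_⟩ ha
    (fun n s hs => (h.isMode n).hasDerivAt_fst s ((hS (ha self_mem_Ici)).trans_lt hs)) ht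
  · rw [inner_sub_right, inner_sub_right, hW.inner_eq n s hs, hL.inner_eq n s (hS hs)]
    ring
  · exact (hf.continuousOn.sub hW.continuousOn).sub (hL.continuousOn.mono hS)

theorem hasDerivAt {W L : ℝ → H} {t : ℝ}
    (hY : HasCoordsOn φ y (Ici 0) Y) (hW : HasCoordsOn φ (fun n t => lam n * y n t) (Ioi 0) W)
    (hL : HasCoordsOn φ (fun n t => lam n * z n t) (Ici 0) L) (hf : Continuous f) (ht : 0 < t) :
    HasDerivAt Y (f t - W t - L t) t :=
  (h.hasDerivWithinAt Ioi_subset_Ici_self hY hW hL hf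
    (fun _ hs => (half_pos ht).trans_le hs) (half_lt_self ht).le).hasDerivAt
    (Ici_mem_nhds (half_lt_self ht))

end IsModeFamily

end ModeFamily

section Regularity

variable {H : Type*} [NormedAddCommGroup H] [InnerProductSpace ℝ H]

theorem contDiffOn_one_of_hasDerivWithinAt {E : Type*} [NormedAddCommGroup E] [NormedSpace ℝ E]
    {Y D : ℝ → E} {s : Set ℝ} (hs : UniqueDiffOn ℝ s)
    (h : ∀ t ∈ s, HasDerivWithinAt Y (D t) s t) (hD : ContinuousOn D s) : ContDiffOn ℝ 1 Y s :=
  (contDiffOn_one_iff_derivWithin hs).2 ⟨fun t ht => (h t ht).differentiableWithinAt,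
    hD.congr fun t ht => (h t ht).derivWithin (hs t ht)⟩

variable {φ : HilbertBasis ℕ ℝ H} {lam : ℕ → ℝ} {A : H →ₗ.[ℝ] H}
  {δ : ℝ} {β : ℝ → ℝ} {f : ℝ → H} {y₀ : H} {V : ℕ → ℝ} {y z : ℕ → ℝ → ℝ} {Y : ℝ → H}

namespace IsWeakSolution

theorem isMode (h : IsWeakSolution A β f y₀ Y) (hφ : IsEigenbasis A φ lam)
    (hβ : EqOn β (fun t => Real.exp (-δ * t)) (Ici 0)) (n : ℕ) :
    IsMode δ (lam n) (fun t => ⟪φ n, f t⟫_ℝ) ⟪φ n, y₀⟫_ℝ (fun t => ⟪φ n, Y t⟫_ℝ)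
      (memory β fun t => ⟪φ n, Y t⟫_ℝ) := by
  have hc : ContinuousOn (fun t => ⟪φ n, Y t⟫_ℝ) (Ici 0) := continuousOn_const.inner h.cont
  obtain ⟨hmc, hmd⟩ := continuousOn_hasDerivAt_memory hβ hc
  refine ⟨by rw [h.init], by simp [memory], hc, hmc, fun t ht => ?_, hmd⟩
  obtain ⟨hn, heig⟩ := hφ.eigen n
  have heqn := h.eqn ⟨φ n, hn⟩ t ht
  simp only [heig, inner_smul_right, real_inner_comm (φ n), mul_left_comm (β _),
    intervalIntegral.integral_const_mul] at heqn
  exact heqn.congr_deriv (by simp only [memory, smul_eq_mul]; ring)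

theorem eqOn (h : IsWeakSolution A β f y₀ Y) {Y' : ℝ → H} (h' : IsWeakSolution A β f y₀ Y')
    (hφ : IsEigenbasis A φ lam) (hδ : 0 < 1 + δ)
    (hβ : EqOn β (fun t => Real.exp (-δ * t)) (Ici 0)) : EqOn Y Y' (Ici 0) := fun _ ht =>
  ext_inner_basis (φ := φ) fun n =>
    ((h.isMode hφ hβ n).eq_of_eq_data hδ (h'.isMode hφ hβ n) ht).1

end IsWeakSolution

variable [CompleteSpace H]

theorem memLp_two_of_summable_integral_inner_sq {ι Ω : Type*} [Countable ι]
    {φ : HilbertBasis ι ℝ H} [MeasurableSpace Ω] {μ : Measure Ω} {Q : Ω → H}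
    (hQ : AEStronglyMeasurable Q μ) (hint : ∀ n, Integrable (fun t => ⟪φ n, Q t⟫_ℝ ^ 2) μ)
    (hsum : Summable fun n => ∫ t, ⟪φ n, Q t⟫_ℝ ^ 2 ∂μ) : MemLp Q 2 μ := by
  rw [memLp_two_iff_integrable_sq_norm hQ]
  refine ⟨hQ.norm.pow 2, (hasFiniteIntegral_iff_ofReal (.of_forall fun t => sq_nonneg _)).2 ?_⟩
  have hparseval : ∀ t, ENNReal.ofReal (‖Q t‖ ^ 2) = ∑' n, ENNReal.ofReal (⟪φ n, Q t⟫_ℝ ^ 2) :=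
    fun t => by
      rw [← (hasSum_inner_sq φ (Q t)).tsum_eq]
      exact ENNReal.ofReal_tsum_of_nonneg (fun n => sq_nonneg _) (hasSum_inner_sq φ (Q t)).summable
  calc ∫⁻ t, ENNReal.ofReal (‖Q t‖ ^ 2) ∂μ
      = ∑' n, ∫⁻ t, ENNReal.ofReal (⟪φ n, Q t⟫_ℝ ^ 2) ∂μ := by
        simp_rw [hparseval]
        exact lintegral_tsum fun n => (hint n).aestronglyMeasurable.aemeasurable.ennreal_ofReal
    _ = ∑' n, ENNReal.ofReal (∫ t, ⟪φ n, Q t⟫_ℝ ^ 2 ∂μ) := tsum_congr fun n =>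
        (ofReal_integral_eq_lintegral_ofReal (hint n) (.of_forall fun t => sq_nonneg _)).symm
    _ = ENNReal.ofReal (∑' n, ∫ t, ⟪φ n, Q t⟫_ℝ ^ 2 ∂μ) :=
        (ENNReal.ofReal_tsum_of_nonneg (fun n => integral_nonneg fun t => sq_nonneg _) hsum).symm
    _ < ⊤ := ENNReal.ofReal_lt_top

namespace IsModeFamily

theorem mem_graph_memory (h : IsModeFamily φ lam δ f y₀ V y z) (hφ : IsEigenbasis A φ lam)
    (hA : A.IsClosed) (hβ : EqOn β (fun t => Real.exp (-δ * t)) (Ici 0))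
    (hY : HasCoordsOn φ y (Ici 0) Y) {L : ℝ → H}
    (hL : HasCoordsOn φ (fun n t => lam n * z n t) (Ici 0) L) {t : ℝ} (ht : 0 ≤ t) :
    (memory β Y t, L t) ∈ A.graph := by
  have hβc := continuousOn_of_eqOn_exp hβ
  refine hφ.mem_graph hA fun n => ?_
  have hn := h.isMode n
  rw [hL.inner_eq n t ht, inner_memory hβc hY.continuousOn ht,
    memory_congr (fun s hs => hY.inner_eq n s hs) ht,
    memory_eq_of_hasDerivAt hβ hn.continuousOn_fst hn.continuousOn_snd hn.init_snd
      hn.hasDerivAt_snd ht]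

theorem memory_mul_fst_eq (h : IsModeFamily φ lam δ f y₀ V y z)
    (hβ : EqOn β (fun t => Real.exp (-δ * t)) (Ici 0)) {W L : ℝ → H}
    (hW : HasCoordsOn φ (fun n t => lam n * y n t) (Ici 0) W)
    (hL : HasCoordsOn φ (fun n t => lam n * z n t) (Ici 0) L) {t : ℝ} (ht : 0 ≤ t) :
    memory β W t = L t := by
  have hβc := continuousOn_of_eqOn_exp hβ
  refine ext_inner_basis (φ := φ) fun n => ?_
  have hn := h.isMode n
  rw [hL.inner_eq n t ht, inner_memory hβc hW.continuousOn ht,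
    memory_congr (fun s hs => hW.inner_eq n s hs) ht,
    memory_eq_of_hasDerivAt hβ (hW.continuousOn_coord n) (hL.continuousOn_coord n)
      (by rw [hn.init_snd, mul_zero])
      (fun s hs => ((hn.hasDerivAt_snd s hs).const_mul (lam n)).congr_deriv (by ring)) ht]

theorem isWeakSolution (h : IsModeFamily φ lam δ f y₀ V y z) (hφ : IsEigenbasis A φ lam)
    (hA : IsSelfAdjoint A) (hδ : 0 ≤ δ) (hβ : EqOn β (fun t => Real.exp (-δ * t)) (Ici 0))
    (hf : Continuous f) (hY : HasCoordsOn φ y (Ici 0) Y) : IsWeakSolution A β f y₀ Y := by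
  refine ⟨hY.continuousOn, h.apply_zero_eq hY, fun w t ht => ?_⟩
  have hβc := continuousOn_of_eqOn_exp hβ
  obtain ⟨W, hW⟩ := h.exists_hasCoordsOn_mul_fst hδ
  obtain ⟨L, hL⟩ := h.exists_hasCoordsOn_mul_snd hδ
  have hYW : (Y t, W t) ∈ A.graph := hφ.mem_graph hA.isClosed fun n => by
    rw [hW.inner_eq n t ht, hY.inner_eq n t ht.le]
  have hmem : ⟪L t, (w : H)⟫_ℝ = ∫ s in (0 : ℝ)..t, β (t - s) * ⟪Y s, A w⟫_ℝ := by
    rw [inner_eq_of_mem_graph hA (h.mem_graph_memory hφ hA.isClosed hβ hY hL ht.le),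
      real_inner_comm, inner_memory hβc hY.continuousOn ht.le]
    simp only [memory, smul_eq_mul, real_inner_comm]
  have hd := (h.hasDerivAt hY hW hL hf ht).inner ℝ (hasDerivAt_const t (w : H))
  rw [← hmem, ← inner_eq_of_mem_graph hA hYW, ← inner_sub_left, ← inner_sub_left]
  simpa only [inner_zero_right, zero_add] using hd

theorem contDiffOn_Ioi (h : IsModeFamily φ lam δ f y₀ V y z) (hδ : 0 ≤ δ) (hf : Continuous f)
    (hY : HasCoordsOn φ y (Ici 0) Y) : ContDiffOn ℝ 1 Y (Ioi 0) := by
  obtain ⟨W, hW⟩ := h.exists_hasCoordsOn_mul_fst hδ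
  obtain ⟨L, hL⟩ := h.exists_hasCoordsOn_mul_snd hδ
  exact contDiffOn_one_of_hasDerivWithinAt (uniqueDiffOn_Ioi 0)
    (fun t ht => (h.hasDerivAt hY hW hL hf ht).hasDerivWithinAt)
    ((hf.continuousOn.sub hW.continuousOn).sub (hL.continuousOn.mono Ioi_subset_Ici_self))

theorem memL2Domain (h : IsModeFamily φ lam δ f y₀ V y z) (hφ : IsEigenbasis A φ lam)
    (hA : A.IsClosed) (hδ : 0 ≤ δ) (hY : HasCoordsOn φ y (Ici 0) Y) {a b : ℝ} (ha : 0 < a) :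
    MemL2Domain A (Ioo a b) Y := by
  obtain ⟨W, hW⟩ := h.exists_hasCoordsOn_mul_fst hδ
  refine ⟨memLp_two_of_continuousOn (hY.continuousOn.mono fun t ht => ha.le.trans ht.1), W,
    memLp_two_of_continuousOn (hW.continuousOn.mono fun t ht => ha.trans_le ht.1), ?_⟩
  filter_upwards [ae_restrict_mem measurableSet_Ioo] with t ht
  have ht0 : 0 < t := ha.trans ht.1
  exact hφ.mem_graph hA fun n => by rw [hW.inner_eq n t ht0, hY.inner_eq n t ht0.le]

theorem memL2Domain_fracPow_half (h : IsModeFamily φ lam δ f y₀ V y z) (hδ : 0 ≤ δ)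
    (hY : HasCoordsOn φ y (Ici 0) Y) {T : ℝ} (hT : 0 ≤ T) :
    MemL2Domain (fracPow φ lam (1 / 2)) (Ioo 0 T) Y := by
  have hyc : ∀ n, ContinuousOn (fun t => lam n ^ (1 / 2 : ℝ) * y n t) (Ici 0) := fun n =>
    continuousOn_const.mul (h.isMode n).continuousOn_fst
  have hdom : IsLocallyDominated (fun n t => lam n ^ (1 / 2 : ℝ) * y n t) (Ioi 0) := by
    refine (h.isLocallyDominated_mul_fst hδ).mono ?_
    filter_upwards [h.eventually_three_le] with n hn t _ using rpow_half_abs_mul_le (by linarith)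
  obtain ⟨Q, hQ⟩ := exists_hasCoordsOn φ hdom fun n => (hyc n).mono Ioi_subset_Ici_self
  have hQsq : ∀ n, EqOn (fun t => ⟪φ n, Q t⟫_ℝ ^ 2)
      (fun t => (lam n ^ (1 / 2 : ℝ) * y n t) ^ 2) (Ioo 0 T) := fun n t ht => by
    simp only [hQ.inner_eq n t ht.1]
  refine ⟨memLp_two_of_continuousOn (hY.continuousOn.mono Icc_subset_Ici_self), Q, ?_, ?_⟩
  · refine memLp_two_of_summable_integral_inner_sq (φ := φ)
      ((hQ.continuousOn.mono Ioo_subset_Ioi_self).aestronglyMeasurable measurableSet_Ioo)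
      (fun n => (integrableOn_congr_fun (hQsq n) measurableSet_Ioo).2 ?_) ?_
    · exact (((hyc n).mono Icc_subset_Ici_self).pow 2).integrableOn_Icc.mono_set
        Ioo_subset_Icc_self
    · simpa only [setIntegral_congr_fun measurableSet_Ioo (hQsq _)]
        using h.summable_integral_mul_sq hδ hT
  · filter_upwards [ae_restrict_mem measurableSet_Ioo] with t ht
    exact mem_graph_fracPow fun n => by rw [hQ.inner_eq n t ht.1, hY.inner_eq n t ht.1.le]

theorem isClassicalSolution (h : IsModeFamily φ lam δ f y₀ V y z) (hφ : IsEigenbasis A φ lam)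
    (hA : A.IsClosed) (hδ : 0 ≤ δ) (hβ : EqOn β (fun t => Real.exp (-δ * t)) (Ici 0))
    (hf : Continuous f) (hy₀ : Memℓp (fun n => lam n * ⟪φ n, y₀⟫_ℝ) 2)
    (hY : HasCoordsOn φ y (Ici 0) Y) : IsClassicalSolution A β f y₀ Y := by
  obtain ⟨W, hW⟩ := h.exists_hasCoordsOn_mul_fst_Ici hδ hy₀
  obtain ⟨L, hL⟩ := h.exists_hasCoordsOn_mul_snd hδ
  refine ⟨h.apply_zero_eq hY, W, hW.continuousOn, fun t ht => ⟨?_, ?_⟩⟩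
  · exact hφ.mem_graph hA fun n => by rw [hW.inner_eq n t ht, hY.inner_eq n t ht]
  · change HasDerivWithinAt Y (f t - W t - memory β W t) (Ici 0) t
    rw [h.memory_mul_fst_eq hβ hW hL ht]
    exact h.hasDerivWithinAt Subset.rfl hY hW hL hf Subset.rfl ht

theorem contDiffOn_Icc (h : IsModeFamily φ lam δ f y₀ V y z) (hδ : 0 ≤ δ)
    (hf : Continuous f) (hy₀ : Memℓp (fun n => lam n * ⟪φ n, y₀⟫_ℝ) 2)
    (hY : HasCoordsOn φ y (Ici 0) Y) {T : ℝ} (hT : 0 < T) : ContDiffOn ℝ 1 Y (Icc 0 T) := by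
  obtain ⟨W, hW⟩ := h.exists_hasCoordsOn_mul_fst_Ici hδ hy₀
  obtain ⟨L, hL⟩ := h.exists_hasCoordsOn_mul_snd hδ
  refine contDiffOn_one_of_hasDerivWithinAt (uniqueDiffOn_Icc hT) (fun t ht => ?_)
    (((hf.continuousOn.sub hW.continuousOn).sub hL.continuousOn).mono Icc_subset_Ici_self)
  exact (h.hasDerivWithinAt Subset.rfl hY hW hL hf Subset.rfl ht.1).mono Icc_subset_Ici_self

end IsModeFamily

end Regularity

section Rank

variable {δ : ℝ} {lam : ℕ → ℝ} {N : ℕ}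

theorem eq_of_common_root (hδ : 0 < 1 + δ) {l k : ℝ} {μ : ℂ}
    (hl : μ ^ 2 - (l + δ) * μ + l * (1 + δ) = 0) (hk : μ ^ 2 - (k + δ) * μ + k * (1 + δ) = 0) :
    l = k := by
  have hprod : ((l : ℂ) - k) * (1 + δ - μ) = 0 := by linear_combination hl - hk
  rcases mul_eq_zero.1 hprod with h | h
  · exact_mod_cast sub_eq_zero.1 h
  · have hδ' : (1 : ℂ) + δ = 0 := by linear_combination hk + (μ - k + 1 : ℂ) * h
    exact absurd (by exact_mod_cast hδ') hδ.ne'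

theorem mul_matP_inl {ι : Type*} (R : Matrix ι (Fin N ⊕ Fin N) ℂ) (δ : ℝ) (lam : ℕ → ℝ) (r : ι)
    (l : Fin N) :
    (R * matP δ lam N) r (Sum.inl l) = -(lam l * (1 + δ) * R r (Sum.inr l)) := by
  simp [matP, Matrix.mul_apply, Matrix.fromBlocks, Matrix.diagonal_apply, mul_comm]

theorem mul_matP_inr {ι : Type*} (R : Matrix ι (Fin N ⊕ Fin N) ℂ) (δ : ℝ) (lam : ℕ → ℝ) (r : ι)
    (l : Fin N) :
    (R * matP δ lam N) r (Sum.inr l) = R r (Sum.inl l) - (lam l + δ) * R r (Sum.inr l) := by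
  simp [matP, Matrix.mul_apply, Matrix.fromBlocks, Matrix.diagonal_apply, Matrix.one_apply,
    mul_comm, sub_eq_add_neg]
  ring

theorem jordanBlock_row (c : ℂ) {n : ℕ} (x : Fin n) :
    jordanBlock c n x = Pi.single x c ∨ ∃ x' : Fin n, x < x' ∧
      jordanBlock c n x = Pi.single x c + Pi.single x' 1 := by
  by_cases hx : (x : ℕ) + 1 < n
  · refine .inr ⟨⟨x + 1, hx⟩, Fin.lt_def.2 (Nat.lt_succ_self _), funext fun a => ?_⟩
    simp only [jordanBlock, Matrix.of_apply, Pi.add_apply, Pi.single_apply, Fin.ext_iff]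
    grind
  · refine .inl (funext fun a => ?_)
    have := a.2
    simp only [jordanBlock, Matrix.of_apply, Pi.single_apply, Fin.ext_iff]
    grind

-- The depth `d r` is the number of rows from `r` to the end of its block.
theorem IsJordanMatrix.exists_chain {ι : Type*} [DecidableEq ι] {J : Matrix ι ι ℂ}
    (hJ : IsJordanMatrix J) :
    ∃ d : ι → ℕ, ∀ r, J r = Pi.single r (J r r) ∨ ∃ r', d r' < d r ∧ J r' r' = J r r ∧
      J r = Pi.single r (J r r) + Pi.single r' 1 := by
  obtain ⟨b, n, c, e, rfl⟩ := hJ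
  set J := Matrix.reindex e e (Matrix.blockDiagonal' fun i => jordanBlock (c i) (n i)) with hJ
  have hrow : ∀ i (x : Fin (n i)) (w : ι → ℂ), (∀ y, jordanBlock (c i) (n i) x y = w (e ⟨i, y⟩)) →
      (∀ j y, j ≠ i → w (e ⟨j, y⟩) = 0) → J (e ⟨i, x⟩) = w := fun i x w hw hw0 => funext fun s => by
    obtain ⟨⟨j, y⟩, rfl⟩ := e.surjective s
    by_cases hij : j = i
    · subst hij
      simp [hJ, hw]
    · simp [hJ, hw0 j y hij, Matrix.blockDiagonal'_apply_ne _ _ _ (Ne.symm hij)]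
  have hdiag : ∀ i (x : Fin (n i)), J (e ⟨i, x⟩) (e ⟨i, x⟩) = c i := fun i x => by
    simp [hJ, jordanBlock]
  let depth : (Σ i, Fin (n i)) → ℕ := fun p => n p.1 - p.2
  refine ⟨depth ∘ e.symm, fun r => ?_⟩
  obtain ⟨⟨i, x⟩, rfl⟩ := e.surjective r
  rw [hdiag]
  rcases jordanBlock_row (c i) x with h | ⟨x', hlt, h⟩
  · exact .inl (hrow i x _ (fun y => by simp [h, Pi.single_apply]) fun j y hij => by simp [hij])
  · refine .inr ⟨e ⟨i, x'⟩, ?_, hdiag i x',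
      hrow i x _ (fun y => by simp [h, Pi.single_apply]) fun j y hij => by simp [hij]⟩
    simp only [Function.comp_apply, e.symm_apply_apply]
    exact Nat.sub_lt_sub_left x.2 hlt

-- The rows of `R` are generalized left eigenvectors of `P`.
theorem row_eq_zero_of_ne {R J : Matrix (Fin N ⊕ Fin N) (Fin N ⊕ Fin N) ℂ}
    (hRP : R * matP δ lam N = J * R) (hJ : IsJordanMatrix J) (r : Fin N ⊕ Fin N) (l : Fin N)
    (hl : J r r ^ 2 + J r r * (lam l + δ) + lam l * (1 + δ) ≠ 0) :
    R r (Sum.inl l) = 0 ∧ R r (Sum.inr l) = 0 := by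
  obtain ⟨d, hd⟩ := hJ.exists_chain
  induction hn : d r using Nat.strong_induction_on generalizing r with
  | _ n ih =>
    have hrow : ∀ s, s = Sum.inl l ∨ s = Sum.inr l →
        (R * matP δ lam N) r s = J r r * R r s := by
      intro s hs
      rw [hRP, Matrix.mul_apply_eq_vecMul, Matrix.vecMul, dotProduct_comm]
      rcases hd r with h | ⟨r', hlt, hdiag, h⟩
      · generalize J r r = c at h ⊢
        simp [h, mul_comm]
      · have hzero := ih _ (hn ▸ hlt) r' (hdiag ▸ hl) rfl
        generalize J r r = c at h ⊢
        rcases hs with rfl | rfl <;> simp [h, hzero, dotProduct_add, mul_comm]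
    have hinl := (mul_matP_inl R δ lam r l).symm.trans (hrow _ (.inl rfl))
    have hinr := (mul_matP_inr R δ lam r l).symm.trans (hrow _ (.inr rfl))
    have hzero : R r (Sum.inr l) = 0 := by
      refine (mul_eq_zero.1 (?_ : (J r r ^ 2 + J r r * (lam l + δ) + lam l * (1 + δ)) *
        R r (Sum.inr l) = 0)).resolve_left hl
      linear_combination (-J r r) * hinr - hinl
    exact ⟨by linear_combination hinr + (J r r + lam l + δ) * hzero, hzero⟩

theorem rank_eq_card_iff_surjective {K m n : Type*} [Field K] [Fintype m] [Fintype n]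
    (A : Matrix m n K) : A.rank = Fintype.card m ↔ Function.Surjective A.mulVec := by
  rw [Matrix.rank, ← Module.finrank_fintype_fun_eq_card K]
  exact ⟨fun h => LinearMap.range_eq_top.1 (Submodule.eq_top_of_finrank_eq h),
    fun h => by rw [LinearMap.range_eq_top.2 h, finrank_top]⟩

theorem rank_eq_card_of_map_ofReal {m n : Type*} [Fintype m] [Fintype n] {A : Matrix m n ℝ}
    (h : (A.map ((↑) : ℝ → ℂ)).rank = Fintype.card m) : A.rank = Fintype.card m := by
  rw [rank_eq_card_iff_surjective] at h ⊢
  intro x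
  obtain ⟨z, hz⟩ := h fun j => (x j : ℂ)
  refine ⟨fun i => (z i).re, funext fun j => ?_⟩
  simpa [Matrix.mulVec, dotProduct] using congrArg Complex.re (congrFun hz j)

/-- The rows of the control matrix `(b i, φ j)` that belong to the eigenvalue `lam k`. -/
def controlBlock {H : Type*} [NormedAddCommGroup H] [InnerProductSpace ℝ H] {ι : Type*}
    (φ : HilbertBasis ℕ ℝ H) (lam : ℕ → ℝ) (b : ι → H) (k : Fin N) :
    Matrix (EigenGroup lam N k) ι ℝ :=
  Matrix.of fun j i => ⟪b i, φ (j : Fin N)⟫_ℝ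

open scoped ComplexOrder in
theorem RankCondition.rank_controlBlock {H : Type*} [NormedAddCommGroup H]
    [InnerProductSpace ℝ H] (hδ : 0 < 1 + δ) {B : H →L[ℝ] H} {φ : HilbertBasis ℕ ℝ H} {M : ℕ}
    (h : RankCondition δ B φ lam N M) (k : Fin N) :
    (controlBlock φ lam (fun i : Fin M => B (φ i)) k).rank
      = Fintype.card (EigenGroup lam N k) := by
  obtain ⟨R, J, hR, hP, hJ, hdiag, -, hrank⟩ := h
  have hRP : R * matP δ lam N = J * R := by
    rw [hP, ← mul_assoc, ← mul_assoc, Matrix.mul_nonsing_inv _ hR, one_mul]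
  set K := controlBlock φ lam (fun i : Fin M => B (φ i)) k
  set S : Matrix (EigenGroup lam N k) (EigenGroup lam N k) ℂ :=
    Matrix.of fun j l => R (Sum.inl (j : Fin N)) (Sum.inr (l : Fin N))
  have hfactor : (R * matQ B φ N M).conjTranspose.submatrix id
      (fun j : EigenGroup lam N k => Sum.inl (j : Fin N))
        = (S * K.map ((↑) : ℝ → ℂ)).conjTranspose := by
    ext i j
    simp only [Matrix.submatrix_apply, Matrix.conjTranspose_apply, id]
    congr 1
    rw [Matrix.mul_apply, Matrix.mul_apply, Fintype.sum_sum_type]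
    simp only [matQ, Matrix.fromRows_apply_inl, Matrix.zero_apply, mul_zero,
      Finset.sum_const_zero, zero_add, Matrix.fromRows_apply_inr, Matrix.of_apply]
    refine (Fintype.sum_of_injective (fun l : EigenGroup lam N k => (l : Fin N))
      Subtype.val_injective _ _ (fun l hl => ?_) fun l => rfl).symm
    have hne : lam l ≠ lam k := fun h => hl ⟨⟨l, h⟩, rfl⟩
    rw [(row_eq_zero_of_ne hRP hJ (Sum.inl (j : Fin N)) l fun hroot => hne ?_).2, zero_mul]
    rw [hdiag, j.2] at hroot
    exact eq_of_common_root hδ (by linear_combination hroot) (muPlus_isRoot δ (lam k))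
  refine rank_eq_card_of_map_ofReal (le_antisymm (Matrix.rank_le_card_height _) ?_)
  rw [← (hrank k).1, hfactor, Matrix.rank_conjTranspose]
  exact Matrix.rank_mul_le_right _ _

end Rank

section Bezout

open Function Polynomial

variable {R V ι : Type*} [CommRing R] [AddCommGroup V] [Module R V] {D : Module.End R V}
  {W : Submodule R V}

theorem aeval_mem_of_forall_mem (hW : ∀ x ∈ W, D x ∈ W) (p : R[X]) {x : V} (hx : x ∈ W) :
    aeval D p x ∈ W :=
  aeval_apply_smul_mem_of_le_comap hx p D hW

-- Bezout for `p k` and the product of the other `p l` splits `p k (D) κ` as a part which solves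
-- away `κ` and a part `θ` which lies in the range of every `p l (D)`.
theorem exists_forall_aeval_eq_of_pairwise_isCoprime [DecidableEq ι]
    (hW : ∀ x ∈ W, D x ∈ W) {p : ι → R[X]} {E : Finset ι}
    (hp : (E : Set ι).Pairwise (IsCoprime on p)) {k : ι} (hk : k ∈ E) {κ : V}
    (hκ : aeval D (p k) κ ∈ W) :
    ∃ θ ∈ W, ∃ ζ : ι → V, ∀ l ∈ E,
      aeval D (p l) (ζ l) = θ ∧ ζ l - (if l = k then κ else 0) ∈ W := by
  set h := aeval D (p k) κ
  set q := ∏ l ∈ E.erase k, p l with hq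
  obtain ⟨a, b, hab⟩ : IsCoprime (p k) q := IsCoprime.prod_right fun l hl =>
    hp hk (Finset.mem_of_mem_erase hl) (Finset.ne_of_mem_erase hl).symm
  have haeval_mul : ∀ (r s : R[X]) x, aeval D (r * s) x = aeval D r (aeval D s x) :=
    fun r s x => by rw [map_mul, Module.End.mul_apply]
  refine ⟨aeval D (b * q) h, aeval_mem_of_forall_mem hW _ hκ, fun l => if l = k then
    κ - aeval D a h else aeval D (b * ∏ j ∈ (E.erase k).erase l, p j) h, fun l hl => ?_⟩
  by_cases hlk : l = k
  · subst hlk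
    refine ⟨?_, by simpa using aeval_mem_of_forall_mem hW a hκ⟩
    have hsum : aeval D (p l * a) h + aeval D (b * q) h = h := by
      rw [← LinearMap.add_apply, ← map_add, mul_comm (p l), hab, map_one, Module.End.one_apply]
    simp only [if_true, map_sub, ← haeval_mul]
    exact sub_eq_of_eq_add' hsum.symm
  · simp only [if_neg hlk, sub_zero, ← haeval_mul]
    refine ⟨?_, aeval_mem_of_forall_mem hW _ hκ⟩
    rw [mul_left_comm, Finset.mul_prod_erase _ p (Finset.mem_erase.2 ⟨hlk, hl⟩)]

end Bezout

section SmoothFunctions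

open Polynomial

variable {δ l k : ℝ}

/-- The space `C^∞(ℝ; ℝ)`. -/
def smoothFun : Submodule ℝ (ℝ → ℝ) where
  carrier := {f | ContDiff ℝ ∞ f}
  add_mem' {f g} (hf : ContDiff ℝ ∞ f) (hg : ContDiff ℝ ∞ g) :=
    show ContDiff ℝ ∞ (f + g) from hf.add hg
  zero_mem' := show ContDiff ℝ ∞ (0 : ℝ → ℝ) from contDiff_const
  smul_mem' c f (hf : ContDiff ℝ ∞ f) := show ContDiff ℝ ∞ (c • f) from hf.const_smul c

instance : CoeFun smoothFun fun _ => ℝ → ℝ := ⟨Subtype.val⟩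

theorem smoothFun_differentiable (f : smoothFun) : Differentiable ℝ f :=
  (contDiff_infty_iff_deriv.1 f.2).1

/-- Differentiation, as an endomorphism of `C^∞(ℝ; ℝ)`. -/
def smoothDeriv : Module.End ℝ smoothFun where
  toFun f := ⟨deriv f, (contDiff_infty_iff_deriv.1 f.2).2⟩
  map_add' f g := Subtype.ext <| funext fun t =>
    deriv_add (smoothFun_differentiable f t) (smoothFun_differentiable g t)
  map_smul' c f := Subtype.ext <| funext fun t =>
    deriv_const_smul c (smoothFun_differentiable f t)

theorem hasDerivAt_smoothDeriv (f : smoothFun) (t : ℝ) : HasDerivAt f (smoothDeriv f t) t :=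
  (smoothFun_differentiable f t).hasDerivAt

/-- The smooth functions that vanish on `U`. -/
def vanishingOn (U : Set ℝ) : Submodule ℝ smoothFun where
  carrier := {f | ∀ t ∈ U, f t = 0}
  add_mem' {f g} hf hg t ht := by
    change f t + g t = 0
    rw [hf t ht, hg t ht, add_zero]
  zero_mem' _ _ := rfl
  smul_mem' c f hf t ht := by
    change c * f t = 0
    rw [hf t ht, mul_zero]

theorem smoothDeriv_mem_vanishingOn {U : Set ℝ} (hU : IsOpen U) :
    ∀ f ∈ vanishingOn U, smoothDeriv f ∈ vanishingOn U := fun f hf t ht => by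
  have hzero : (f : ℝ → ℝ) =ᶠ[𝓝 t] fun _ => 0 := by
    filter_upwards [hU.mem_nhds ht] with s hs using hf s hs
  exact hzero.deriv_eq.trans (deriv_const t 0)

/-- The characteristic polynomial of the modes with eigenvalue `l`, in the variable `d/dt`. Its
roots are `-μ⁺` and `-μ⁻`. -/
def modePoly (δ l : ℝ) : ℝ[X] := X ^ 2 + C (l + δ) * X + C (l * (1 + δ))

theorem aeval_modePoly (δ l : ℝ) (f : smoothFun) (t : ℝ) :
    aeval smoothDeriv (modePoly δ l) f t
      = smoothDeriv (smoothDeriv f) t + (l + δ) * smoothDeriv f t + l * (1 + δ) * f t := by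
  simp [modePoly, pow_two]
  ring

theorem isCoprime_modePoly (hδ : 1 + δ ≠ 0) (h : l ≠ k) :
    IsCoprime (modePoly δ l) (modePoly δ k) := by
  have hδ' : (C (1 / (1 + δ)) : ℝ[X]) * C (1 + δ) = 1 := by
    rw [← C_mul, one_div_mul_cancel hδ, C_1]
  have hlk : (C (1 / (l - k)) : ℝ[X]) * C (l - k) = 1 := by
    rw [← C_mul, one_div_mul_cancel (sub_ne_zero.2 h), C_1]
  refine ⟨C (1 / (1 + δ)) * (1 - C (1 / (l - k)) * (X + C (l - 1))),
    C (1 / (1 + δ)) * C (1 / (l - k)) * (X + C (l - 1)), ?_⟩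
  simp only [modePoly, C_add, C_mul, C_sub, C_1] at hδ' hlk ⊢
  linear_combination hδ' - (C (1 / (1 + δ)) * (X + (C l - 1)) * (X + 1 + C δ)) * hlk

theorem isMode_of_aeval_modePoly {g : ℝ → ℝ} {ζ : smoothFun}
    (hg : ∀ t, aeval smoothDeriv (modePoly δ l) ζ t = g t) (hζ : ζ 0 = 0) :
    IsMode δ l g (smoothDeriv ζ 0) (fun t => smoothDeriv ζ t + δ * ζ t) ζ where
  init_fst := by simp [hζ]
  init_snd := hζ
  continuousOn_fst := ((smoothFun_differentiable (smoothDeriv ζ)).continuous.add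
    ((smoothFun_differentiable ζ).continuous.const_mul δ)).continuousOn
  continuousOn_snd := (smoothFun_differentiable ζ).continuous.continuousOn
  hasDerivAt_fst t _ := by
    refine ((hasDerivAt_smoothDeriv (smoothDeriv ζ) t).add
      ((hasDerivAt_smoothDeriv ζ t).const_mul δ)).congr_deriv ?_
    rw [← hg, aeval_modePoly]
    ring
  hasDerivAt_snd t _ := (hasDerivAt_smoothDeriv ζ t).congr_deriv (by ring)

theorem exists_fundamental_solution (δ l : ℝ) :
    ∃ K : smoothFun, K 0 = 0 ∧ smoothDeriv K 0 = 1 ∧ aeval smoothDeriv (modePoly δ l) K = 0 := by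
  obtain ⟨y, z, hy0, hz0, hy, hz⟩ := exists_hasDerivAt_mode δ l (f := fun _ => 0)
    continuous_const 1
  have hy' : deriv y = fun t => 0 - l * (y t + z t) := funext fun t => (hy t).deriv
  have hz' : deriv z = fun t => y t - δ * z t := funext fun t => (hz t).deriv
  have hsmooth : ∀ n : ℕ, ContDiff ℝ n y ∧ ContDiff ℝ n z := by
    intro n
    induction n with
    | zero =>
      simp only [Nat.cast_zero, contDiff_zero]
      exact ⟨continuous_iff_continuousAt.2 fun t => (hy t).continuousAt,
        continuous_iff_continuousAt.2 fun t => (hz t).continuousAt⟩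
    | succ n ih =>
      obtain ⟨hyn, hzn⟩ := ih
      push_cast
      rw [contDiff_succ_iff_deriv, contDiff_succ_iff_deriv, hy', hz']
      exact ⟨⟨fun t => (hy t).differentiableAt, by simp, by fun_prop⟩,
        ⟨fun t => (hz t).differentiableAt, by simp, by fun_prop⟩⟩
  let K : smoothFun := ⟨z, contDiff_infty.2 fun n => (hsmooth n).2⟩
  have hK' : ∀ t, smoothDeriv K t = y t - δ * K t := fun t => (hz t).deriv
  have hK'' : ∀ t, smoothDeriv (smoothDeriv K) t
      = (0 - l * (y t + K t)) - δ * (y t - δ * K t) := fun t => by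
    refine HasDerivAt.deriv (?_ : HasDerivAt (deriv z) _ t)
    rw [hz']
    exact (hy t).sub ((hz t).const_mul δ)
  refine ⟨K, hz0, by rw [hK', hy0, show K 0 = 0 from hz0]; ring,
    Subtype.ext <| funext fun t => ?_⟩
  rw [aeval_modePoly, hK'', hK']
  change _ = (0 : ℝ)
  ring

end SmoothFunctions

section NullControl

open Polynomial Matrix

variable {δ : ℝ}

-- Cutting off a fundamental solution of the mode `k` between the times `1` and `2` gives a forcing
-- that steers this mode to rest; it is then corrected to keep the other modes at rest outside
-- `[1, 2]`.
theorem exists_null_control_of_finset (hδ : 1 + δ ≠ 0) {E : Finset ℝ} {k : ℝ} (hk : k ∈ E) :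
    ∃ θ ∈ vanishingOn (Icc 1 2)ᶜ, ∃ ζ : ℝ → smoothFun, ∀ l ∈ E,
      aeval smoothDeriv (modePoly δ l) (ζ l) = θ ∧ ζ l ∈ vanishingOn (Ioi 2) ∧
      ζ l 0 = 0 ∧ smoothDeriv (ζ l) 0 = if l = k then 1 else 0 := by
  obtain ⟨K, hK0, hK1, hK⟩ := exists_fundamental_solution δ k
  let κ : smoothFun := ⟨fun t => Real.smoothTransition (2 - t) * K t,
    (Real.smoothTransition.contDiff.comp (contDiff_const.sub contDiff_id)).mul K.2⟩
  have hκ : κ ∈ vanishingOn (Ioi 2) := fun t (ht : 2 < t) => by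
    change Real.smoothTransition (2 - t) * K t = 0
    rw [Real.smoothTransition.zero_of_nonpos (by linarith), zero_mul]
  have hκK : κ - K ∈ vanishingOn (Iio 1) := fun t (ht : t < 1) => by
    change Real.smoothTransition (2 - t) * K t - K t = 0
    rw [Real.smoothTransition.one_of_one_le (by linarith), one_mul, sub_self]
  have hstable := smoothDeriv_mem_vanishingOn (isClosed_Icc (a := (1 : ℝ)) (b := 2)).isOpen_compl
  have hforcing : aeval smoothDeriv (modePoly δ k) κ ∈ vanishingOn (Icc 1 2)ᶜ := fun t ht => by
    rcases lt_or_ge t 1 with ht1 | ht1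
    · rw [← sub_zero (aeval smoothDeriv (modePoly δ k) κ), ← hK, ← map_sub]
      exact aeval_mem_of_forall_mem (smoothDeriv_mem_vanishingOn isOpen_Iio) _ hκK t ht1
    · exact aeval_mem_of_forall_mem (smoothDeriv_mem_vanishingOn isOpen_Ioi) _ hκ t
        (not_le.1 fun ht2 => ht ⟨ht1, ht2⟩)
  obtain ⟨θ, hθ, ζ, hζ⟩ := exists_forall_aeval_eq_of_pairwise_isCoprime hstable
    (fun l _ l' _ h => isCoprime_modePoly hδ h) hk hforcing
  have hinit : (0 : ℝ) ∈ (Icc (1 : ℝ) 2)ᶜ := fun h => by linarith [h.1]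
  have hκ0 : κ 0 = 0 := (sub_eq_zero.1 (hκK 0 (mem_Iio.2 one_pos))).trans hK0
  have hκ1 : smoothDeriv κ 0 = 1 := by
    have h := smoothDeriv_mem_vanishingOn isOpen_Iio _ hκK 0 (mem_Iio.2 one_pos)
    rw [map_sub] at h
    exact (sub_eq_zero.1 h).trans hK1
  refine ⟨θ, hθ, ζ, fun l hl => ?_⟩
  obtain ⟨hζθ, hζκ⟩ := hζ l hl
  have hζκ' := hstable _ hζκ 0 hinit
  refine ⟨hζθ, ?_⟩
  split_ifs at hζκ hζκ' ⊢
  · rw [map_sub] at hζκ'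
    exact ⟨fun t (ht : 2 < t) => (sub_eq_zero.1 (hζκ t fun h => ht.not_ge h.2)).trans (hκ t ht),
      (sub_eq_zero.1 (hζκ 0 hinit)).trans hκ0, (sub_eq_zero.1 hζκ').trans hκ1⟩
  · rw [sub_zero] at hζκ hζκ'
    exact ⟨fun t (ht : 2 < t) => hζκ t fun h => ht.not_ge h.2, hζκ 0 hinit, hζκ'⟩

theorem exists_null_control (hδ : 1 + δ ≠ 0) {ι m : Type*} [Fintype ι] [Finite m] [DecidableEq m]
    {lam : m → ℝ} {c : Matrix m ι ℝ}
    (hc : ∀ k, ∃ x : ι → ℝ, ∀ j, lam j = lam k → (c *ᵥ x) j = if j = k then 1 else 0) :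
    ∃ v : ι → (m → ℝ) →ₗ[ℝ] smoothFun, (∀ i a, v i a ∈ vanishingOn (Icc 1 2)ᶜ) ∧
      ∀ a j, ∃ ζ ∈ vanishingOn (Ioi 2), ζ 0 = 0 ∧ smoothDeriv ζ 0 = a j ∧
        aeval smoothDeriv (modePoly δ (lam j)) ζ = ∑ i, c j i • v i a := by
  have := Fintype.ofFinite m
  have hmem : ∀ j, lam j ∈ Finset.univ.image lam := fun j =>
    Finset.mem_image_of_mem lam (Finset.mem_univ j)
  choose x hx using hc
  choose θ hθ ζ hζ using fun k => exists_null_control_of_finset hδ (hmem k)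
  refine ⟨fun i => ∑ k, x k i • (LinearMap.proj k).smulRight (θ k), fun i a => ?_, fun a j =>
    ⟨∑ k, (a k * (c *ᵥ x k) j) • ζ k (lam j), ?_, ?_, ?_, ?_⟩⟩
  · simp only [LinearMap.sum_apply, LinearMap.smul_apply, LinearMap.smulRight_apply]
    exact sum_mem fun k _ => Submodule.smul_mem _ _ (Submodule.smul_mem _ _ (hθ k))
  · exact sum_mem fun k _ => Submodule.smul_mem _ _ (hζ k _ (hmem j)).2.1
  · simp [(hζ _ _ (hmem j)).2.2.1]
  · have hterm : ∀ k, a k * (c *ᵥ x k) j * (if lam j = lam k then 1 else 0)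
        = if j = k then a k else 0 := fun k => by
      by_cases h : lam j = lam k
      · simp [h, hx k j h]
      · simp [h, show j ≠ k from fun hjk => h (hjk ▸ rfl)]
    simp [(hζ _ _ (hmem j)).2.2.2, hterm]
  · simp only [map_sum, map_smul, (hζ _ _ (hmem j)).1, LinearMap.sum_apply, LinearMap.smul_apply,
      LinearMap.smulRight_apply, LinearMap.proj_apply, Finset.smul_sum, smul_smul]
    rw [Finset.sum_comm]
    refine Finset.sum_congr rfl fun k _ => ?_
    rw [← Finset.sum_smul, Matrix.mulVec, dotProduct, Finset.mul_sum]
    exact congrArg (· • θ k) (Finset.sum_congr rfl fun i _ => by ring)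

/-- The size of the `2`-jet of a smooth function at `t`. -/
def jetSeminorm (t : ℝ) : Seminorm ℝ smoothFun :=
  Seminorm.of (fun f => |f t| + |smoothDeriv f t| + |smoothDeriv (smoothDeriv f) t|)
    (fun f g => by
      simp only [map_add, Submodule.coe_add, Pi.add_apply]
      linarith [abs_add_le (f t) (g t), abs_add_le (smoothDeriv f t) (smoothDeriv g t),
        abs_add_le (smoothDeriv (smoothDeriv f) t) (smoothDeriv (smoothDeriv g) t)])
    (fun c f => by simp [abs_mul, mul_add])

theorem jetSeminorm_apply (t : ℝ) (f : smoothFun) :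
    jetSeminorm t f = |f t| + |smoothDeriv f t| + |smoothDeriv (smoothDeriv f) t| := rfl

theorem jetSeminorm_eq_derivWithin {t : ℝ} (ht : 0 ≤ t) (f : smoothFun) :
    jetSeminorm t f = |f t| + |derivWithin f (Ici 0) t| + |iteratedDerivWithin 2 f (Ici 0) t| := by
  rw [(smoothFun_differentiable f t).derivWithin (uniqueDiffOn_Ici 0 t ht),
    iteratedDerivWithin_eq_iteratedDeriv (uniqueDiffOn_Ici 0) (contDiff_infty.1 f.2 2).contDiffAt
      ht, iteratedDeriv_succ, iteratedDeriv_one]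
  rfl

theorem abs_apply_le_jetSeminorm (t : ℝ) (f : smoothFun) : |f t| ≤ jetSeminorm t f := by
  rw [jetSeminorm_apply]
  linarith [abs_nonneg (smoothDeriv f t), abs_nonneg (smoothDeriv (smoothDeriv f) t)]

theorem exists_jetSeminorm_le {θ : smoothFun} (h : θ ∈ vanishingOn (Icc 1 2)ᶜ) (r : ℝ) :
    ∃ c : ℝ, 0 ≤ c ∧ ∀ t, jetSeminorm t θ ≤ c * Real.exp (-r * t) := by
  obtain ⟨c, hc⟩ := (isCompact_Icc (a := (1 : ℝ)) (b := 2)).exists_bound_of_continuousOn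
    (f := fun t => jetSeminorm t θ * Real.exp (r * t)) <| by
      have h0 := (smoothFun_differentiable θ).continuous
      have h1 := (smoothFun_differentiable (smoothDeriv θ)).continuous
      have h2 := (smoothFun_differentiable (smoothDeriv (smoothDeriv θ))).continuous
      simp only [jetSeminorm_apply]
      fun_prop
  have hc0 : 0 ≤ c := (norm_nonneg _).trans (hc 1 (by norm_num))
  refine ⟨c, hc0, fun t => ?_⟩
  by_cases ht : t ∈ Icc (1 : ℝ) 2
  · rw [neg_mul, Real.exp_neg, ← div_eq_mul_inv, le_div_iff₀ (Real.exp_pos _)]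
    exact (le_abs_self _).trans (hc t ht)
  · have hstable := smoothDeriv_mem_vanishingOn (isClosed_Icc (a := (1 : ℝ)) (b := 2)).isOpen_compl
    rw [jetSeminorm_apply, h t ht, hstable _ h t ht, hstable _ (hstable _ h) t ht]
    simp only [abs_zero, add_zero]
    positivity

theorem exists_jetSeminorm_le_mul_norm {m : Type*} [Fintype m] {v : (m → ℝ) →ₗ[ℝ] smoothFun}
    (hv : ∀ a, v a ∈ vanishingOn (Icc 1 2)ᶜ) (r : ℝ) :
    ∃ c : ℝ, 0 ≤ c ∧ ∀ a t, jetSeminorm t (v a) ≤ c * ‖a‖ * Real.exp (-r * t) := by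
  classical
  choose c hc0 hc using fun k => exists_jetSeminorm_le (hv fun j => if k = j then 1 else 0) r
  refine ⟨∑ k, c k, Finset.sum_nonneg fun k _ => hc0 k, fun a t => ?_⟩
  rw [LinearMap.pi_apply_eq_sum_univ v a, Finset.sum_mul, Finset.sum_mul]
  refine (Finset.le_sum_of_subadditive _ (map_zero _).le (map_add_le_add _) _ _).trans
    (Finset.sum_le_sum fun k _ => ?_)
  rw [map_smul_eq_mul, mul_comm (c k), mul_assoc]
  exact mul_le_mul (norm_le_pi_norm a k) (hc k t) (apply_nonneg _ _) (norm_nonneg a)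

end NullControl

section Stabilization

open Matrix

variable {H : Type*} [NormedAddCommGroup H] [InnerProductSpace ℝ H] {ι : Type*} [Fintype ι]
  {φ : HilbertBasis ℕ ℝ H} {lam : ℕ → ℝ} {δ γ : ℝ} {N : ℕ} {b : ι → H}

theorem exists_mulVec_eq_single_of_rank {k : Fin N}
    (h : (controlBlock φ lam b k).rank = Fintype.card (EigenGroup lam N k)) :
    ∃ x : ι → ℝ, ∀ j : Fin N, lam j = lam k →
      (Matrix.of (fun (j : Fin N) i => ⟪b i, φ j⟫_ℝ) *ᵥ x) j = if j = k then 1 else 0 := by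
  obtain ⟨x, hx⟩ := (rank_eq_card_iff_surjective _).1 h (Pi.single ⟨k, rfl⟩ 1)
  refine ⟨x, fun j hj => (congrFun hx ⟨j, hj⟩).trans ?_⟩
  rw [Pi.single_apply]
  simp only [Subtype.mk.injEq]

theorem exists_null_control_of_rank (hδ : 0 < 1 + δ)
    (hrank : ∀ k : Fin N,
      (controlBlock φ lam b k).rank = Fintype.card (EigenGroup lam N k)) (r : ℝ) :
    ∃ K : ℝ, 0 ≤ K ∧ ∀ y₀ : H, ∃ v : ι → smoothFun,
      (∀ s ≤ r, ∀ i t, 0 ≤ t → jetSeminorm t (v i) ≤ K * ‖y₀‖ * Real.exp (-s * t)) ∧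
      ∀ (j : Fin N) (y z : ℝ → ℝ),
        IsMode δ (lam j) (fun t => ⟪φ j, ∑ i, v i t • b i⟫_ℝ) ⟪φ j, y₀⟫_ℝ y z →
        ∀ t, 2 < t → y t = 0 := by
  obtain ⟨v, hv, hnull⟩ := exists_null_control (δ := δ) hδ.ne'
    fun k => exists_mulVec_eq_single_of_rank (hrank k)
  choose c hc0 hc using fun i => exists_jetSeminorm_le_mul_norm (hv i) r
  refine ⟨∑ i, c i, Finset.sum_nonneg fun i _ => hc0 i, fun y₀ =>
    ⟨fun i => v i fun j => ⟪φ j, y₀⟫_ℝ, fun s hs i t ht => ?_, fun j y z hmode t ht => ?_⟩⟩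
  · have hcoord : ‖fun j : Fin N => ⟪φ j, y₀⟫_ℝ‖ ≤ ‖y₀‖ :=
      (pi_norm_le_iff_of_nonneg (norm_nonneg y₀)).2 fun j => by
        simpa [φ.orthonormal.1] using norm_inner_le_norm (𝕜 := ℝ) (φ j) y₀
    have hci : c i ≤ ∑ i, c i := Finset.single_le_sum (fun i _ => hc0 i) (Finset.mem_univ i)
    have hexp : Real.exp (-r * t) ≤ Real.exp (-s * t) :=
      Real.exp_le_exp.2 (mul_le_mul_of_nonneg_right (neg_le_neg hs) ht)
    have hK : 0 ≤ ∑ i, c i := (hc0 i).trans hci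
    exact (hc i _ t).trans (mul_le_mul (mul_le_mul hci hcoord (norm_nonneg _) hK) hexp
      (Real.exp_pos _).le (by positivity))
  · obtain ⟨ζ, hζ, hζ0, hζ1, hζeq⟩ := hnull (fun j => ⟪φ j, y₀⟫_ℝ) j
    have hζmode := isMode_of_aeval_modePoly (fun s => congrArg (fun g : smoothFun => g s) hζeq) hζ0
    rw [hζ1] at hζmode
    have hforce : (fun t => ⟪φ j, ∑ i, v i (fun j => ⟪φ j, y₀⟫_ℝ) t • b i⟫_ℝ)
        = (∑ i, Matrix.of (fun (j : Fin N) i => ⟪b i, φ j⟫_ℝ) j i •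
            v i (fun j => ⟪φ j, y₀⟫_ℝ) : smoothFun) := funext fun t => by
      simp [inner_sum, inner_smul_right, real_inner_comm, mul_comm]
    rw [hforce] at hmode
    have hζ' := smoothDeriv_mem_vanishingOn isOpen_Ioi ζ hζ t ht
    rw [(hmode.eq_of_eq_data hδ hζmode (by linarith)).1, hζ t ht, hζ', mul_zero, add_zero]

theorem continuous_sum_smul (v : ι → smoothFun) (b : ι → H) :
    Continuous fun t => ∑ i, v i t • b i :=
  continuous_finsetSum _ fun i _ =>
    (smoothFun_differentiable (v i)).continuous.smul continuous_const

theorem abs_inner_sum_smul_le (φ : HilbertBasis ℕ ℝ H) (b : ι → H) {a : ι → ℝ} {s e : ℝ}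
    (ha : ∀ i, |a i| ≤ s * e) (n : ℕ) :
    |⟪φ n, ∑ i, a i • b i⟫_ℝ| ≤ ⟪φ n, s • ∑ i, modulus φ (b i)⟫_ℝ * e := by
  rw [inner_smul_right, mul_right_comm]
  simp only [inner_sum, inner_smul_right, inner_modulus, Finset.mul_sum]
  refine (Finset.abs_sum_le_sum_abs _ _).trans (Finset.sum_le_sum fun i _ => ?_)
  rw [abs_mul]
  exact mul_le_mul_of_nonneg_right (ha i) (abs_nonneg _)

theorem norm_le_of_isDecayConst [CompleteSpace H] {f Y : ℝ → H} {y₀ u : H} {y z : ℕ → ℝ → ℝ}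
    {D T t : ℝ} (hD0 : 0 ≤ D) (hD : ∀ n, IsDecayConst δ γ (lam n) (fun t => n < N → t ≤ T) D)
    (hmode : ∀ n, IsMode δ (lam n) (fun t => ⟪φ n, f t⟫_ℝ) ⟪φ n, y₀⟫_ℝ (y n) (z n))
    (hf : ∀ n t, 0 < t → |⟪φ n, f t⟫_ℝ| ≤ ⟪φ n, u⟫_ℝ * Real.exp (-(γ + 1) * t))
    (hnull : ∀ n < N, ∀ t, T < t → y n t = 0) (hY : HasCoordsOn φ y (Ici 0) Y) (ht : 0 ≤ t) :
    ‖Y t‖ ≤ D * Real.exp (-γ * t) * (‖y₀‖ + ‖u‖) := by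
  have hc : 0 ≤ D * Real.exp (-γ * t) := by positivity
  have hu : ∀ n, 0 ≤ ⟪φ n, u⟫_ℝ := fun n =>
    nonneg_of_mul_nonneg_left ((abs_nonneg _).trans (hf n 1 one_pos)) (Real.exp_pos _)
  have hcoord : ∀ n, |⟪φ n, Y t⟫_ℝ|
      ≤ |⟪φ n, (D * Real.exp (-γ * t)) • (modulus φ y₀ + u)⟫_ℝ| := fun n => by
    rw [hY.inner_eq n t ht, inner_smul_right, inner_add_right, inner_modulus, abs_mul,
      abs_of_nonneg hc, abs_of_nonneg (add_nonneg (abs_nonneg _) (hu n))]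
    by_cases hn : n < N → t ≤ T
    · exact (hD n _ _ _ _ _ (hmode n) (hf n) t ht hn).trans_eq (by ring)
    · obtain ⟨hnN, htT⟩ : n < N ∧ T < t := by simpa using hn
      rw [hnull n hnN t htT, abs_zero]
      exact mul_nonneg hc (add_nonneg (abs_nonneg _) (hu n))
  calc ‖Y t‖ ≤ ‖(D * Real.exp (-γ * t)) • (modulus φ y₀ + u)‖ :=
        norm_le_norm_of_abs_inner_le hcoord
    _ = D * Real.exp (-γ * t) * ‖modulus φ y₀ + u‖ := norm_smul_of_nonneg hc _
    _ ≤ D * Real.exp (-γ * t) * (‖y₀‖ + ‖u‖) := mul_le_mul_of_nonneg_left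
        ((norm_add_le _ _).trans (add_le_add_left (norm_modulus_le y₀) _)) hc

theorem exists_stabilizing_control [CompleteSpace H] (hδ : 0 ≤ δ) (hγ : γ < δ + 1)
    (hlam : Tendsto lam atTop atTop) (hN : unstableDim δ γ lam ≤ N)
    (hrank : ∀ k : Fin N,
      (controlBlock φ lam b k).rank = Fintype.card (EigenGroup lam N k)) :
    ∃ C : ℝ, 0 < C ∧ ∀ y₀ : H, ∃ (v : ι → smoothFun) (V : ℕ → ℝ) (y z : ℕ → ℝ → ℝ) (Y : ℝ → H),
      (∀ i t, 0 ≤ t → jetSeminorm t (v i) ≤ C * Real.exp (-γ * t) * ‖y₀‖) ∧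
      IsModeFamily φ lam δ (fun t => ∑ i, v i t • b i) y₀ V y z ∧
      HasCoordsOn φ y (Ici 0) Y ∧
      ∀ t, 0 ≤ t → ‖Y t‖ ≤ C * Real.exp (-γ * t) * ‖y₀‖ := by
  obtain ⟨D, hD0, hD⟩ := exists_uniform_isDecayConst hδ hγ hlam hN 2
  obtain ⟨K, hK0, hK⟩ :=
    exists_null_control_of_rank (by linarith : 0 < 1 + δ) hrank (max (γ + 1) 0)
  set w : H := ∑ i, modulus φ (b i)
  have hC : 0 ≤ D * (1 + K * ‖w‖) := by positivity
  refine ⟨D * (1 + K * ‖w‖) + K + 1, by positivity, fun y₀ => ?_⟩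
  obtain ⟨v, hv, hnull⟩ := hK y₀
  have hforce : ∀ s ≤ max (γ + 1) 0, ∀ n t, 0 < t → |⟪φ n, ∑ i, v i t • b i⟫_ℝ|
      ≤ ⟪φ n, (K * ‖y₀‖) • w⟫_ℝ * Real.exp (-s * t) := fun s hs n t ht =>
    abs_inner_sum_smul_le φ b
      (fun i => (abs_apply_le_jetSeminorm t (v i)).trans (hv s hs i t ht.le)) n
  choose y z hmode using fun n => exists_isMode δ (lam n)
    (continuous_const.inner (continuous_sum_smul v b)) ⟪φ n, y₀⟫_ℝ
  have hfam : IsModeFamily φ lam δ (fun t => ∑ i, v i t • b i) y₀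
      (fun n => ⟪φ n, (K * ‖y₀‖) • w⟫_ℝ) y z :=
    ⟨Nat.cofinite_eq_atTop ▸ hlam, hmode,
      fun n t ht => by simpa using hforce 0 (le_max_right _ _) n t ht, memℓp_inner φ _⟩
  obtain ⟨Y, hY⟩ := hfam.exists_hasCoordsOn_fst hδ
  refine ⟨v, _, y, z, Y, fun i t ht => ?_, hfam, hY, fun t ht => ?_⟩
  · have hγr : γ ≤ max (γ + 1) 0 := (le_add_of_nonneg_right zero_le_one).trans (le_max_left _ _)
    refine (hv γ hγr i t ht).trans ?_
    rw [mul_right_comm]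
    gcongr
    linarith
  · have hdecay := norm_le_of_isDecayConst hD0 hD hmode (hforce _ (le_max_left _ _))
      (fun n hn => hnull ⟨n, hn⟩ _ _ (hmode n)) hY ht
    rw [norm_smul_of_nonneg (by positivity)] at hdecay
    calc ‖Y t‖ ≤ D * Real.exp (-γ * t) * (‖y₀‖ + K * ‖y₀‖ * ‖w‖) := hdecay
      _ = D * (1 + K * ‖w‖) * Real.exp (-γ * t) * ‖y₀‖ := by ring
      _ ≤ (D * (1 + K * ‖w‖) + K + 1) * Real.exp (-γ * t) * ‖y₀‖ := by gcongr; linarith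

end Stabilization

end PIDE

end

-- Where `lam n < 0` the power `lam n ^ (1 / 2)` is `0`; this changes `A ^ (1 / 2)` only on finitely
-- many modes.
theorem mainTheorem5_general {H ι : Type*} [NormedAddCommGroup H] [InnerProductSpace ℝ H]
    [CompleteSpace H] [Fintype ι] {A : H →ₗ.[ℝ] H} (hA : IsSelfAdjoint A)
    (hAc : PIDE.HasCompactResolvent A) {φ : HilbertBasis ℕ ℝ H} {lam : ℕ → ℝ}
    (hφ : PIDE.IsEigenbasis A φ lam) {b : ι → H} {δ γ : ℝ} (hδ : 0 ≤ δ) (hγ : γ < δ + 1)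
    {β : ℝ → ℝ} (hβ0 : β 0 = 1) (hβc : ContinuousOn β (Set.Ici 0))
    (hβ : ∀ t : ℝ, 0 < t → HasDerivAt β (-(δ * β t)) t)
    {N : ℕ} (hN : PIDE.unstableDim δ γ lam ≤ N)
    (hrank : ∀ k : Fin N,
      (PIDE.controlBlock φ lam b k).rank = Fintype.card (PIDE.EigenGroup lam N k)) :
    ∃ C : ℝ, 0 < C ∧ ∀ y₀ : H, ∃ (v : ι → ℝ → ℝ) (y : ℝ → H),
      (∀ j, ContDiffOn ℝ 2 (v j) (Set.Ici 0)) ∧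
      (∀ j, ∀ t : ℝ, 0 ≤ t →
        |v j t| + |derivWithin (v j) (Set.Ici 0) t|
          + |iteratedDerivWithin 2 (v j) (Set.Ici 0) t|
            ≤ C * Real.exp (-γ * t) * ‖y₀‖) ∧
      PIDE.IsWeakSolution A β (fun t => ∑ i, v i t • b i) y₀ y ∧
      (∀ z : ℝ → H, PIDE.IsWeakSolution A β (fun t => ∑ i, v i t • b i) y₀ z →
        Set.EqOn z y (Set.Ici 0)) ∧
      ContDiffOn ℝ 1 y (Set.Ioi 0) ∧
      (∀ T : ℝ, 0 < T → PIDE.MemL2Domain (PIDE.fracPow φ lam (1 / 2)) (Set.Ioo 0 T) y) ∧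
      (∀ a b : ℝ, 0 < a → a < b → PIDE.MemL2Domain A (Set.Ioo a b) y) ∧
      (y₀ ∈ A.domain →
        PIDE.IsClassicalSolution A β (fun t => ∑ i, v i t • b i) y₀ y ∧
        ∀ T : ℝ, 0 < T → ContDiffOn ℝ 1 y (Set.Icc 0 T)) ∧
      (∀ t : ℝ, 0 ≤ t → ‖y t‖ ≤ C * Real.exp (-γ * t) * ‖y₀‖) := by
  have hβexp := PIDE.eqOn_exp_of_hasDerivAt hβ0 hβc hβ
  obtain ⟨C, hC, hstab⟩ :=
    PIDE.exists_stabilizing_control hδ hγ (hφ.tendsto_atTop hAc) hN hrank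
  refine ⟨C, hC, fun y₀ => ?_⟩
  obtain ⟨v, V, y, z, Y, hv, hfam, hY, hdecay⟩ := hstab y₀
  have hf := PIDE.continuous_sum_smul v b
  have hweak := hfam.isWeakSolution hφ hA hδ hβexp hf hY
  have hdom : y₀ ∈ A.domain → Memℓp (fun n => lam n * ⟪φ n, y₀⟫_ℝ) 2 := fun h => by
    simpa only [hφ.inner_apply hA] using PIDE.memℓp_inner φ (A ⟨y₀, h⟩)
  exact ⟨fun i => v i, Y, fun i => (contDiff_infty.1 (v i).2 2).contDiffOn,
    fun i t ht => (PIDE.jetSeminorm_eq_derivWithin ht (v i)).symm.trans_le (hv i t ht),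
    hweak, fun _ h => h.eqOn hweak hφ (by linarith) hβexp, hfam.contDiffOn_Ioi hδ hf hY,
    fun T hT => hfam.memL2Domain_fracPow_half hδ hY hT.le,
    fun a b ha _ => hfam.memL2Domain hφ hA.isClosed hδ hY ha,
    fun h => ⟨hfam.isClassicalSolution hφ hA.isClosed hδ hβexp hf (hdom h) hY,
      fun T hT => hfam.contDiffOn_Icc hδ hf (hdom h) hY hT⟩, hdecay⟩

theorem mainTheorem5 {H : Type*} [NormedAddCommGroup H] [InnerProductSpace ℝ H] [CompleteSpace H]
    (A : H →ₗ.[ℝ] H) (hA : PIDE.IsAdmissible A)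
    (φ : HilbertBasis ℕ ℝ H) (lam : ℕ → ℝ) (hφ : PIDE.IsEigenbasis A φ lam)
    (B : H →L[ℝ] H)
    (δ : ℝ) (hδ : 0 < δ)
    (β : ℝ → ℝ) (hβ0 : β 0 = 1) (hβc : ContinuousOn β (Set.Ici 0))
    (hβ : ∀ t : ℝ, 0 < t → HasDerivAt β (-(δ * β t)) t)
    (γ : ℝ) (hγ0 : 0 < γ) (hγ1 : γ < δ + 1)
    (N : ℕ) (hN : N = PIDE.unstableDim δ γ lam)
    (M : ℕ) (hM : M = PIDE.maxMult lam N)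
    (hrank : PIDE.RankCondition δ B φ lam N M) :
    ∃ ψ : Fin M → H,
      (PIDE.IsSemisimpleSpectrum δ lam N → ∀ j : Fin M, ψ j = φ j) ∧
      (∀ j : Fin M, ψ j ∈ Submodule.span ℝ (Set.range fun i : Fin M => φ i)) ∧
      ∃ C : ℝ, 0 < C ∧ ∀ y₀ : H, ∃ (v : Fin M → ℝ → ℝ) (y : ℝ → H),
        -- regularity and decay of the control
        (∀ j, ContDiffOn ℝ 2 (v j) (Set.Ici 0)) ∧
        (∀ j, ∀ t : ℝ, 0 ≤ t →
          |v j t| + |derivWithin (v j) (Set.Ici 0) t|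
            + |iteratedDerivWithin 2 (v j) (Set.Ici 0) t|
              ≤ C * Real.exp (-γ * t) * ‖y₀‖) ∧
        -- `y` is the unique solution driven by the control
        PIDE.IsWeakSolution A β (fun t => ∑ i, v i t • B (ψ i)) y₀ y ∧
        (∀ z : ℝ → H, PIDE.IsWeakSolution A β (fun t => ∑ i, v i t • B (ψ i)) y₀ z →
          Set.EqOn z y (Set.Ici 0)) ∧
        -- regularity of the solution
        ContDiffOn ℝ 1 y (Set.Ioi 0) ∧
        (∀ T : ℝ, 0 < T → PIDE.MemL2Domain (PIDE.fracPow φ lam (1 / 2)) (Set.Ioo 0 T) y) ∧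
        (∀ a b : ℝ, 0 < a → a < b → PIDE.MemL2Domain A (Set.Ioo a b) y) ∧
        (y₀ ∈ A.domain →
          PIDE.IsClassicalSolution A β (fun t => ∑ i, v i t • B (ψ i)) y₀ y ∧
          ∀ T : ℝ, 0 < T → ContDiffOn ℝ 1 y (Set.Icc 0 T)) ∧
        -- exponential decay of the solution
        (∀ t : ℝ, 0 ≤ t → ‖y t‖ ≤ C * Real.exp (-γ * t) * ‖y₀‖) := by
  subst hN
  exact ⟨fun i => φ i, fun _ _ => rfl, fun j => Submodule.subset_span ⟨j, rfl⟩,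
    mainTheorem5_general hA.selfAdjoint hA.compactResolvent hφ hδ.le hγ1 hβ0 hβc hβ le_rfl
      (hrank.rank_controlBlock (by linarith))⟩
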